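/- Notation. $\|\cdot\|$ and $\langle\cdot,\cdot\rangle$ are the Euclidean norm and inner product, and $\mathbb R_+=[0,\infty)$. $\mathcal K$ is the set of continuous, strictly increasing $\varphi:\mathbb R_+\to\mathbb R_+$ with $\varphi(0)=0$; $\mathcal K_\infty$ is the set of unbounded elements of $\mathcal K$; $\mathcal{KL}$ is the set of $\psi:\mathbb R_+\times\mathbb R_+\to\mathbb R_+$ such that $\psi(\cdot,t)\in\mathcal K$ for each $t\ge 0$ and, for each $s\ge 0$, $\psi(s,\cdot)$ is non-increasing with $\psi(s,t)\to0$ as $t\to\infty$. A function $g:\mathbb R_+\to\mathbb R_+$ is linearly bounded if there is $a>0$ with $g(s)\le as$ for all $s\ge0$. Data. Let $A\in\mathbb R^{n\times n}$, $B\in\mathbb R^{n\times m}$, $C\in\mathbb R^{m\times n}$. Let $\theta\in\mathcal K_\infty$ be continuously differentiable on $\mathbb R_+$ (one-sided at $0$), let $\alpha:\mathbb R_+\to\mathbb R_+$ satisfy $\alpha\le\theta$, and let $c,\mu>0$ with $c\mu\ge1$. Define $F:\mathbb R^m\rightrightarrows\mathbb R^m$ by $$F(y)=\big\{w\in\mathbb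 R^m:\ \|w\|\le\theta(\|y\|),\ \ \langle w,y\rangle\ge\|y\|\,\alpha(\|y\|),\ \text{ and }\ c\langle w,y\rangle\ge\|w\|\ \text{ if } \|y\|>\mu\big\}.$$ Let $\mathcal B$ be the set of pairs $(v,x)$ with $v\in L^\infty_{\rm loc}(\mathbb R_+,\mathbb R^m)$ and $x\in W^{1,1}_{\rm loc}(\mathbb R_+,\mathbb R^n)$ (i.e. $x$ absolutely continuous on each $[0,T]$) such that $$\dot x(t)-Ax(t)-Bv(t)\in -BF(Cx(t))\qquad\text{for almost every } t\ge0. \tag{L}$$ The inclusion (L) is called *ISS* if there exist $\psi\in\mathcal{KL}$ and $\varphi\in\mathcal K$ such that $$\|x(t)\|\le\psi(\|x(0)\|,t)+\varphi(\|v\|_{L^\infty(0,t)})\qquad\forall\, t\ge0,\ \forall\,(v,x)\in\mathcal B,$$ and *exponentially ISS* if there exist $M,\gamma>0$ such that $$\|x(t)\|\le M\big(e^{-\gamma t}\|x(0)\|+\|v\|_{L^\infty(0,t)}\big)\qquad\forall\, t\ge0,\ \forall\,(v,x)\in\mathcal B. \tag{E}$$ Theorem. Assume that the pair $(C,A)$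 is detectable (there is $H\in\mathbb R^{n\times m}$ such that every eigenvalue of $A+HC$ has negative real part) and that there exists a symmetric positive semi-definite $P\in\mathbb R^{n\times n}$ such that $$\begin{pmatrix}A^\top P+PA & PB-C^\top\\ B^\top P-C & 0\end{pmatrix}\le 0 .$$ 1. If $\alpha\in\mathcal K_\infty$, then (L) is ISS. Assume now that $\alpha\in\mathcal K_\infty$ and that there is $\varepsilon_0>0$ with $\alpha(s)\ge\varepsilon_0 s$ for all $s\ge0$. Then, furthermore: 2. (L) is semi-globally exponentially ISS: for every $R>0$ there exist $M,\gamma>0$ such that the inequality in (E) holds for all $t\ge0$ and all $(v,x)\in\mathcal B$ with $v\in L^\infty(\mathbb R_+,\mathbb R^m)$ and $\|x(0)\|+\|v\|_{L^\infty(\mathbb R_+)}\le R$. 3. If $\theta$ is linearly bounded, then (L) is exponentially ISS. The comparison functions $\psi,\varphi$ and the constants $M,\gamma$ depend only on $(A,B,C)$, $\alpha,\theta,\mu,c$ and, in 2., on $R$. -/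

import Mathlib

open MeasureTheory Set Filter Topology
open scoped Matrix

/-! ### Comparison functions

Functions on the half line `[0, ∞)` are represented by functions `ℝ → ℝ`, of which only the values
on `Set.Ici 0` matter. -/

/-- Class `𝒦`: continuous, strictly increasing on `[0, ∞)`, zero at zero. -/
structure IsClassK (φ : ℝ → ℝ) : Prop where
  continuousOn : ContinuousOn φ (Ici 0)
  map_zero : φ 0 = 0
  strictMonoOn : StrictMonoOn φ (Ici 0)

/-- Class `𝒦_∞`: the unbounded functions of class `𝒦`. -/
structure IsClassKInf (φ : ℝ → ℝ) : Prop extends IsClassK φ where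
  unbounded : ¬ BddAbove (φ '' Ici 0)

/-- Class `𝒦ℒ`; the second argument is time. -/
structure IsClassKL (ψ : ℝ → ℝ → ℝ) : Prop where
  classK : ∀ t, 0 ≤ t → IsClassK fun s => ψ s t
  antitoneOn : ∀ s, 0 ≤ s → AntitoneOn (ψ s) (Ici 0)
  tendsto_zero : ∀ s, 0 ≤ s → Tendsto (ψ s) atTop (𝓝 0)

/-- `g : ℝ₊ → ℝ₊` is linearly bounded. -/
def IsLinearlyBounded (g : ℝ → ℝ) : Prop :=
  ∃ a : ℝ, 0 < a ∧ ∀ s, 0 ≤ s → |g s| ≤ a * |s|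

/-! ### Linear data -/

/-- A real square matrix is Hurwitz if all its (complex) eigenvalues have negative real part. -/
def IsHurwitz {n : ℕ} (A : Matrix (Fin n) (Fin n) ℝ) : Prop :=
  ∀ z ∈ spectrum ℂ (A.map (algebraMap ℝ ℂ)), z.re < 0

/-- The pair `(C, A)` is detectable: some output injection makes `A` Hurwitz. -/
def IsDetectable {n m : ℕ} (C : Matrix (Fin m) (Fin n) ℝ) (A : Matrix (Fin n) (Fin n) ℝ) : Prop :=
  ∃ H : Matrix (Fin n) (Fin m) ℝ, IsHurwitz (A + H * C)

/-- The linear matrix inequality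
`[AᵀP + PA, PB - Cᵀ; BᵀP - C, 0] ≤ 0` (negative semi-definiteness of the block matrix). -/
def PositiveRealLMI {n m : ℕ} (A : Matrix (Fin n) (Fin n) ℝ) (B : Matrix (Fin n) (Fin m) ℝ)
    (C : Matrix (Fin m) (Fin n) ℝ) (P : Matrix (Fin n) (Fin n) ℝ) : Prop :=
  (-(Matrix.fromBlocks (Aᵀ * P + P * A) (P * B - Cᵀ) (Bᵀ * P - C) 0)).PosSemidef

/-! ### Lur'e inclusions -/

/-- Trajectories `(v, x)` of the forced Lur'e inclusion `ẋ - A x - B v ∈ -B F(C x)` on `[0, ∞)`: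
`v ∈ L¹_loc([0, ∞), ℝᵐ)`, `x ∈ W^{1,1}_loc([0, ∞), ℝⁿ)` (that is, `x` is absolutely continuous on
every `[0, T]`), and the inclusion holds for almost every `t ≥ 0`. -/
def lureBehaviour {n m : ℕ} (A : Matrix (Fin n) (Fin n) ℝ) (B : Matrix (Fin n) (Fin m) ℝ)
    (C : Matrix (Fin m) (Fin n) ℝ)
    (F : EuclideanSpace ℝ (Fin m) → Set (EuclideanSpace ℝ (Fin m))) :
    Set ((ℝ → EuclideanSpace ℝ (Fin m)) × (ℝ → EuclideanSpace ℝ (Fin n))) :=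
  {p | LocallyIntegrableOn p.1 (Ici 0) ∧
    (∀ T, 0 ≤ T → AbsolutelyContinuousOnInterval p.2 0 T) ∧
    ∀ᵐ t ∂(volume.restrict (Ici (0 : ℝ))), ∃ x' : EuclideanSpace ℝ (Fin n),
      HasDerivAt p.2 x' t ∧
      x' - A.toEuclideanLin (p.2 t) - B.toEuclideanLin (p.1 t) ∈
        (fun w => -(B.toEuclideanLin w)) '' F (C.toEuclideanLin (p.2 t))}

/-- Trajectories whose forcing term `v` is in `L^∞_loc([0, ∞), ℝᵐ)`. -/
def lureBehaviourInf {n m : ℕ} (A : Matrix (Fin n) (Fin n) ℝ) (B : Matrix (Fin n) (Fin m) ℝ)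
    (C : Matrix (Fin m) (Fin n) ℝ)
    (F : EuclideanSpace ℝ (Fin m) → Set (EuclideanSpace ℝ (Fin m))) :
    Set ((ℝ → EuclideanSpace ℝ (Fin m)) × (ℝ → EuclideanSpace ℝ (Fin n))) :=
  {p | p ∈ lureBehaviour A B C F ∧ ∀ T, 0 ≤ T → MemLp p.1 ⊤ (volume.restrict (Icc 0 T))}

/-- The norm `‖v‖_{L^∞(0, t)}` (used only for `v` essentially bounded on `(0, t)`). -/
noncomputable def supNormUpTo {m : ℕ} (v : ℝ → EuclideanSpace ℝ (Fin m)) (t : ℝ) : ℝ :=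
  (eLpNorm v ⊤ (volume.restrict (Ioo 0 t))).toReal

/-- The norm `‖v‖_{L^∞(0, ∞)}` (used only for `v` essentially bounded on `(0, ∞)`). -/
noncomputable def supNormHalfLine {m : ℕ} (v : ℝ → EuclideanSpace ℝ (Fin m)) : ℝ :=
  (eLpNorm v ⊤ (volume.restrict (Ici (0 : ℝ)))).toReal

/-- Input-to-state stability of the Lur'e inclusion `(A, B, C, F)`. -/
def IsISS {n m : ℕ} (A : Matrix (Fin n) (Fin n) ℝ) (B : Matrix (Fin n) (Fin m) ℝ)
    (C : Matrix (Fin m) (Fin n) ℝ)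
    (F : EuclideanSpace ℝ (Fin m) → Set (EuclideanSpace ℝ (Fin m))) : Prop :=
  ∃ (ψ : ℝ → ℝ → ℝ) (φ : ℝ → ℝ), IsClassKL ψ ∧ IsClassK φ ∧
    ∀ v x, (v, x) ∈ lureBehaviourInf A B C F → ∀ t, 0 ≤ t →
      ‖x t‖ ≤ ψ ‖x 0‖ t + φ (supNormUpTo v t)

/-- Exponential input-to-state stability of the Lur'e inclusion `(A, B, C, F)`. -/
def IsExpISS {n m : ℕ} (A : Matrix (Fin n) (Fin n) ℝ) (B : Matrix (Fin n) (Fin m) ℝ)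
    (C : Matrix (Fin m) (Fin n) ℝ)
    (F : EuclideanSpace ℝ (Fin m) → Set (EuclideanSpace ℝ (Fin m))) : Prop :=
  ∃ M γ : ℝ, 0 < M ∧ 0 < γ ∧
    ∀ v x, (v, x) ∈ lureBehaviourInf A B C F → ∀ t, 0 ≤ t →
      ‖x t‖ ≤ M * (Real.exp (-γ * t) * ‖x 0‖ + supNormUpTo v t)

/-- Semi-global exponential input-to-state stability of the Lur'e inclusion `(A, B, C, F)`. -/
def IsSemiGlobalExpISS {n m : ℕ} (A : Matrix (Fin n) (Fin n) ℝ) (B : Matrix (Fin n) (Fin m) ℝ)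
    (C : Matrix (Fin m) (Fin n) ℝ)
    (F : EuclideanSpace ℝ (Fin m) → Set (EuclideanSpace ℝ (Fin m))) : Prop :=
  ∀ R : ℝ, 0 < R → ∃ M γ : ℝ, 0 < M ∧ 0 < γ ∧
    ∀ v x, (v, x) ∈ lureBehaviourInf A B C F →
      MemLp v ⊤ (volume.restrict (Ici (0 : ℝ))) → ‖x 0‖ + supNormHalfLine v ≤ R →
      ∀ t, 0 ≤ t → ‖x t‖ ≤ M * (Real.exp (-γ * t) * ‖x 0‖ + supNormUpTo v t)

/-- The set-valued sector nonlinearity with bounding data `θ, α, μ, c`. -/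
def sectorMap {m : ℕ} (θ α : ℝ → ℝ) (μ c : ℝ) (y : EuclideanSpace ℝ (Fin m)) :
    Set (EuclideanSpace ℝ (Fin m)) :=
  {w | ‖w‖ ≤ θ ‖y‖ ∧ ‖y‖ * α ‖y‖ ≤ inner ℝ w y ∧ (μ < ‖y‖ → ‖w‖ ≤ c * inner ℝ w y)}

/-- The standing requirement `F(0) = {0}` in the stability notions holds for the sector map. -/
theorem sectorMap_zero {m : ℕ} {θ : ℝ → ℝ} (hθ : θ 0 = 0) (α : ℝ → ℝ) (μ c : ℝ) :
    sectorMap (m := m) θ α μ c 0 = {0} := by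
  ext w
  constructor
  · rintro ⟨h, -⟩
    rw [norm_zero, hθ] at h
    exact norm_le_zero_iff.mp h
  · rintro rfl
    simp [sectorMap, hθ]

/-!
Let `y = C x` be the output, `w ∈ F(y)` the feedback, and `s = ⟨w, y⟩ ≥ ‖y‖ α(‖y‖)`. Along a
trajectory `ẋ = A x + B (v - w)`, so two quadratic forms govern the stability of the inclusion.

* The linear matrix inequality says that `V = ⟨P x, x⟩` is a storage function for passivity
  (`PositiveRealLMI.inner_le`), hence `V̇ ≤ 2 ⟨y, v⟩ - 2 s`: it dissipates `s`, but need not be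
  definite.
* Lyapunov's theorem for `A + H C` (`IsHurwitz.exists_lyapunov`) gives a definite form
  `N² = ⟨Q x, x⟩ ≥ ‖x‖²` whose derivative is at most
  `-2 a N² + 2 b N (‖y‖ + ‖w‖ + ‖v‖)` (`IsDetectable.exists_lyapunov`).

If `‖w‖ ≤ a₀ ‖y‖` and `s ≥ ε ‖y‖²`, then `N² + K V` with `K` large is a quadratic Lyapunov function
and Gronwall's inequality gives exponential stability (`isExpISS_linearSectorMap`). This is the case
of linearly bounded `θ`.

In general `‖w‖` is neither small relative to `‖y‖` nor bounded, and the cross term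
`N (‖y‖ + ‖w‖)` is compensated only after replacing `N²` by `ρ(N²)`, where
`ρ'(N²) = k(N) / (1 + N)`. The factor `1 / (1 + N)` makes the weighted cross term bounded by a
multiple of `‖y‖ + ‖w‖`, which for `‖y‖ > μ` is at most a multiple of `s` by the last condition in
the definition of the sector. The factor `k`, chosen in `exists_weight_sectorMap`, takes care of
`‖y‖ ≤ μ`. Then `U = ρ(N²) + K V` satisfies `U̇ ≤ -rate(U) + σ(‖v‖)` with class `𝒦_∞` functions, and
input-to-state stability follows from the comparison principle
`AbsolutelyContinuousOnInterval.le_or_add_mul_le_of_deriv_le`. The latter bounds `U(t)` by the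
solution `u` of `u + t rate(u) / 2 = U(0)` instead of that of a differential equation.

Semi-global exponential stability is a consequence of the two previous results: trajectories with
bounded data have bounded output, and on bounded sets the `C¹` function `θ` is linearly bounded.
-/

/-! ### Lyapunov's theorem for Hurwitz matrices -/

open scoped Matrix.Norms.L2Operator in
/-- Consequence of Gelfand's formula for the spectral radius. -/
theorem Matrix.tendsto_pow_zero_of_spectrum {n : ℕ} (M : Matrix (Fin n) (Fin n) ℂ)
    (h : ∀ z ∈ spectrum ℂ M, ‖z‖ < 1) : Tendsto (fun k : ℕ => M ^ k) atTop (𝓝 0) := by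
  rcases isEmpty_or_nonempty (Fin n) with hn | hn
  · have : (fun k : ℕ => M ^ k) = fun _ => 0 := funext fun k => Subsingleton.elim _ _
    rw [this]
    exact tendsto_const_nhds
  · have hr : spectralRadius ℂ M < (1 : NNReal) :=
      spectrum.spectralRadius_lt_of_forall_lt M fun z hz => by
        rw [← NNReal.coe_lt_coe]
        simpa using h z hz
    obtain ⟨r, hMr, hr1⟩ := ENNReal.lt_iff_exists_nnreal_btwn.mp hr
    have hr1' : r < 1 := by exact_mod_cast hr1
    have hev := (spectrum.pow_nnnorm_pow_one_div_tendsto_nhds_spectralRadius M).eventually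
      (gt_mem_nhds hMr)
    rw [tendsto_zero_iff_norm_tendsto_zero]
    refine squeeze_zero' (Eventually.of_forall fun _ => norm_nonneg _) ?_
      (tendsto_pow_atTop_nhds_zero_of_lt_one r.2 (by exact_mod_cast hr1'))
    filter_upwards [hev, eventually_gt_atTop 0] with k hk hk0
    have hk' : ((‖M ^ k‖₊ : ENNReal) ^ (1 / k : ℝ)) ^ (k : ℝ) ≤ (r : ENNReal) ^ (k : ℝ) :=
      ENNReal.rpow_le_rpow hk.le (by positivity)
    rw [← ENNReal.rpow_mul, one_div_mul_cancel (by positivity), ENNReal.rpow_one,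
      ENNReal.rpow_natCast] at hk'
    exact_mod_cast hk'

theorem Matrix.tendsto_pow_zero_of_spectrum_map {n : ℕ} (M : Matrix (Fin n) (Fin n) ℝ)
    (h : ∀ z ∈ spectrum ℂ (M.map (algebraMap ℝ ℂ)), ‖z‖ < 1) :
    Tendsto (fun k : ℕ => M ^ k) atTop (𝓝 0) := by
  have h1 := Matrix.tendsto_pow_zero_of_spectrum _ h
  refine tendsto_pi_nhds.mpr fun i => tendsto_pi_nhds.mpr fun j => ?_
  have h3 := (Complex.continuous_re.tendsto _).comp
    (tendsto_pi_nhds.mp (tendsto_pi_nhds.mp h1 i) j)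
  have key : ∀ k : ℕ, (M.map (algebraMap ℝ ℂ)) ^ k = (M ^ k).map (algebraMap ℝ ℂ) := fun k =>
    (map_pow (algebraMap ℝ ℂ).mapMatrix M k).symm
  have h4 : Tendsto (fun k : ℕ => (M ^ k) i j) atTop (𝓝 ((0 : ℂ).re)) := by
    refine h3.congr fun k => ?_
    rw [Function.comp_apply, key k]
    simp
  simpa using h4

theorem Matrix.algebraMap_mem_spectrum_map {n : ℕ} {A : Matrix (Fin n) (Fin n) ℝ} {r : ℝ}
    (hr : ¬ IsUnit (algebraMap ℝ (Matrix (Fin n) (Fin n) ℝ) r - A)) :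
    (r : ℂ) ∈ spectrum ℂ (A.map (algebraMap ℝ ℂ)) := by
  rw [spectrum.mem_iff]
  intro h
  apply hr
  have h1 : algebraMap ℂ (Matrix (Fin n) (Fin n) ℂ) r - A.map (algebraMap ℝ ℂ)
      = (algebraMap ℝ ℂ).mapMatrix (algebraMap ℝ (Matrix (Fin n) (Fin n) ℝ) r - A) := by
    ext i j
    by_cases hij : i = j <;> simp [Matrix.algebraMap_matrix_apply, hij]
  rw [h1, Matrix.isUnit_iff_isUnit_det, ← RingHom.map_det, isUnit_iff_ne_zero] at h
  rw [Matrix.isUnit_iff_isUnit_det, isUnit_iff_ne_zero]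
  intro h0
  exact h (by rw [h0, map_zero])

theorem Complex.norm_one_add_lt_norm_one_sub {z : ℂ} (hz : z.re < 0) : ‖1 + z‖ < ‖1 - z‖ := by
  rw [← sq_lt_sq₀ (norm_nonneg _) (norm_nonneg _), ← Complex.normSq_eq_norm_sq,
    ← Complex.normSq_eq_norm_sq, Complex.normSq_apply, Complex.normSq_apply]
  simp
  nlinarith

/-- The Cayley transform of a Hurwitz matrix has its spectrum in the open unit disc. -/
theorem IsHurwitz.norm_lt_one_of_mem_spectrum_cayley {n : ℕ} {A : Matrix (Fin n) (Fin n) ℝ}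
    (hA : IsHurwitz A) {S : Matrix (Fin n) (Fin n) ℝ} (hS : (1 - A) * S = 1) {z : ℂ}
    (hz : z ∈ spectrum ℂ (((1 + A) * S).map (algebraMap ℝ ℂ))) : ‖z‖ < 1 := by
  set φ : Matrix (Fin n) (Fin n) ℝ →+* Matrix (Fin n) (Fin n) ℂ := (algebraMap ℝ ℂ).mapMatrix
  change z ∈ spectrum ℂ (φ ((1 + A) * S)) at hz
  have hA' : ∀ z ∈ spectrum ℂ (φ A), z.re < 0 := hA
  have hS1 : (1 - φ A) * φ S = 1 := by rw [← map_one φ, ← map_sub, ← map_mul, hS]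
  have hS2 : φ S * (1 - φ A) = 1 := mul_eq_one_comm.mp hS1
  have hu : IsUnit (1 - φ A) := ⟨⟨_, _, hS1, hS2⟩, rfl⟩
  rw [map_mul, map_add, map_one, spectrum.mem_iff] at hz
  have key : (algebraMap ℂ _ z - (1 + φ A) * φ S) * (1 - φ A)
      = algebraMap ℂ _ (z - 1) - (z + 1) • φ A := by
    rw [sub_mul, mul_assoc, hS2, mul_one, Algebra.algebraMap_eq_smul_one,
      Algebra.algebraMap_eq_smul_one, smul_mul_assoc, one_mul]
    module
  have hn : ¬ IsUnit (algebraMap ℂ (Matrix (Fin n) (Fin n) ℂ) (z - 1) - (z + 1) • φ A) := by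
    rw [← key]
    intro h
    apply hz
    have := h.mul (⟨⟨_, _, hS2, hS1⟩, rfl⟩ : IsUnit (φ S))
    rwa [mul_assoc, hS1, mul_one] at this
  by_cases h1 : z + 1 = 0
  · exfalso
    apply hn
    rw [h1, zero_smul, sub_zero]
    refine (isUnit_iff_ne_zero.mpr ?_).map (algebraMap ℂ (Matrix (Fin n) (Fin n) ℂ))
    rw [eq_neg_of_add_eq_zero_left h1]
    norm_num
  · have hmem : (z - 1) / (z + 1) ∈ spectrum ℂ (φ A) := by
      rw [spectrum.mem_iff]
      intro h
      apply hn
      have h2 := ((isUnit_iff_ne_zero.mpr h1).map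
        (algebraMap ℂ (Matrix (Fin n) (Fin n) ℂ))).mul h
      rwa [mul_sub, ← map_mul, mul_div_cancel₀ _ h1, ← Algebra.smul_def] at h2
    have hlt := Complex.norm_one_add_lt_norm_one_sub (hA' _ hmem)
    have e1 : 1 + (z - 1) / (z + 1) = z * (2 / (z + 1)) := by field_simp; ring
    have e2 : 1 - (z - 1) / (z + 1) = 2 / (z + 1) := by field_simp; ring
    rw [e1, e2, norm_mul] at hlt
    have hpos : 0 < ‖2 / (z + 1)‖ := norm_pos_iff.mpr (by simp [h1])
    exact (mul_lt_iff_lt_one_left hpos).mp hlt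

/-- Lyapunov's theorem: a Hurwitz matrix admits a positive definite quadratic form that decreases
along the flow. The form is `∑ k < K, ‖Mᵏ x‖²`, where `M` is the Cayley transform of the matrix and
`K` is so large that `‖M ^ K‖ < 1`. -/
theorem IsHurwitz.exists_lyapunov {n : ℕ} {A : Matrix (Fin n) (Fin n) ℝ} (hA : IsHurwitz A) :
    ∃ (Q : EuclideanSpace ℝ (Fin n) →L[ℝ] EuclideanSpace ℝ (Fin n)) (δ : ℝ), 0 < δ ∧
      (∀ x y, inner ℝ (Q x) y = inner ℝ x (Q y)) ∧ (∀ x, ‖x‖ ^ 2 ≤ inner ℝ (Q x) x) ∧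
      ∀ x, inner ℝ (Q x) (A.toEuclideanLin x) ≤ -δ * ‖x‖ ^ 2 := by
  have hu : IsUnit (1 - A) := by
    by_contra h
    have h1 := Matrix.algebraMap_mem_spectrum_map (A := A) (r := 1) (by rwa [map_one])
    have := hA _ h1
    norm_num at this
  obtain ⟨S, hS⟩ := hu.exists_right_inv
  have hS' : S * (1 - A) = 1 := mul_eq_one_comm.mp hS
  set M := (1 + A) * S with hM
  have hMS : M * (1 - A) = 1 + A := by rw [hM, mul_assoc, hS', mul_one]
  have htend := Matrix.tendsto_pow_zero_of_spectrum_map M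
    fun z hz => hA.norm_lt_one_of_mem_spectrum_cayley hS hz
  set L := Matrix.toEuclideanCLM (n := Fin n) (𝕜 := ℝ) with hL
  have hcont : Continuous (fun X : Matrix (Fin n) (Fin n) ℝ => L X) :=
    LinearMap.continuous_of_finiteDimensional L.toAlgEquiv.toLinearMap
  have htend' : Tendsto (fun k : ℕ => ‖L (M ^ k)‖) atTop (𝓝 0) := by
    have := ((hcont.norm).tendsto 0).comp htend
    simpa [Function.comp_def] using this
  obtain ⟨K, hK, hK1⟩ := ((htend'.eventually (gt_mem_nhds (zero_lt_one' ℝ))).and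
    (eventually_gt_atTop 0)).exists
  set Q := ∑ k ∈ Finset.range K, (L (M ^ k)).adjoint ∘L L (M ^ k) with hQ
  have hQi : ∀ x y, inner ℝ (Q x) y = ∑ k ∈ Finset.range K,
      inner ℝ (L (M ^ k) x) (L (M ^ k) y) := by
    intro x y
    simp [hQ, sum_inner, ContinuousLinearMap.adjoint_inner_left]
  have hsymm : ∀ x y, inner ℝ (Q x) y = inner ℝ x (Q y) := by
    intro x y
    rw [hQi, real_inner_comm, hQi]
    exact Finset.sum_congr rfl fun k _ => real_inner_comm _ _
  -- Stein equation for the Cayley transform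
  have hstein : ∀ u, inner ℝ (Q (L M u)) (L M u) - inner ℝ (Q u) u
      = ‖L (M ^ K) u‖ ^ 2 - ‖u‖ ^ 2 := by
    intro u
    rw [hQi, hQi, ← Finset.sum_sub_distrib]
    have : ∀ k ∈ Finset.range K, inner ℝ (L (M ^ k) (L M u)) (L (M ^ k) (L M u)) -
        inner ℝ (L (M ^ k) u) (L (M ^ k) u) = ‖L (M ^ (k + 1)) u‖ ^ 2 - ‖L (M ^ k) u‖ ^ 2 := by
      intro k _
      rw [← mul_apply_eq_comp, ← map_mul, ← pow_succ, real_inner_self_eq_norm_sq,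
        real_inner_self_eq_norm_sq]
    rw [Finset.sum_congr rfl this, Finset.sum_range_sub (fun k => ‖L (M ^ k) u‖ ^ 2)]
    simp
  set a := ‖L (M ^ K)‖
  set b := ‖L S‖ + 1
  have hb : 0 < b := by positivity
  have ha1 : 0 < 1 - a ^ 2 := by
    have : 0 ≤ a := norm_nonneg _
    nlinarith
  refine ⟨Q, (1 - a ^ 2) / (4 * b ^ 2), by positivity, hsymm, fun x => ?_, fun x => ?_⟩
  · rw [hQi]
    calc ‖x‖ ^ 2 = inner ℝ (L (M ^ 0) x) (L (M ^ 0) x) := by simp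
      _ ≤ _ := Finset.single_le_sum (f := fun k => inner ℝ (L (M ^ k) x) (L (M ^ k) x))
        (fun k _ => real_inner_self_nonneg) (Finset.mem_range.mpr hK1)
  · set u := L (1 - A) x with hu
    have hLA : A.toEuclideanLin x = L A x := rfl
    have h1 : L M u = x + L A x := by
      rw [hu, ← mul_apply_eq_comp, ← map_mul, hMS, map_add, map_one]
      rfl
    have h2 : u = x - L A x := by rw [hu, map_sub, map_one]; rfl
    have h3 := hstein u
    have hxu : L S u = x := by
      rw [hu, ← mul_apply_eq_comp, ← map_mul, hS', map_one]; rfl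
    rw [h1] at h3
    have h4 : inner ℝ (Q (x + L A x)) (x + L A x) - inner ℝ (Q u) u
        = 4 * inner ℝ (Q x) (L A x) := by
      rw [h2]
      simp only [map_add, map_sub, inner_add_left, inner_add_right, inner_sub_left,
        inner_sub_right]
      rw [hsymm (L A x) x, real_inner_comm (Q x) (L A x)]
      ring
    have h5 : ‖L (M ^ K) u‖ ≤ a * ‖u‖ := ContinuousLinearMap.le_opNorm _ _
    have h6 : ‖x‖ ≤ b * ‖u‖ := by
      calc ‖x‖ = ‖L S u‖ := by rw [hxu]
        _ ≤ ‖L S‖ * ‖u‖ := ContinuousLinearMap.le_opNorm _ _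
        _ ≤ b * ‖u‖ := by gcongr; simp [b]
    have h7 : ‖L (M ^ K) u‖ ^ 2 ≤ a ^ 2 * ‖u‖ ^ 2 := by
      rw [← mul_pow]; gcongr
    have h8 : ‖x‖ ^ 2 ≤ b ^ 2 * ‖u‖ ^ 2 := by
      rw [← mul_pow]; gcongr
    have h9 : (1 - a ^ 2) / (4 * b ^ 2) * ‖x‖ ^ 2 ≤ (1 - a ^ 2) / 4 * ‖u‖ ^ 2 := by
      calc (1 - a ^ 2) / (4 * b ^ 2) * ‖x‖ ^ 2
          ≤ (1 - a ^ 2) / (4 * b ^ 2) * (b ^ 2 * ‖u‖ ^ 2) := by gcongr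
        _ = _ := by field_simp
    rw [hLA]
    linarith

/-! ### Quadratic storage functions -/

/-- The matrix inequality in terms of quadratic forms: the form of `P` is a storage function for
the passivity of the system `ẋ = A x + B u`, `y = C x`. -/
theorem PositiveRealLMI.inner_le {n m : ℕ} {A : Matrix (Fin n) (Fin n) ℝ}
    {B : Matrix (Fin n) (Fin m) ℝ} {C : Matrix (Fin m) (Fin n) ℝ} {P : Matrix (Fin n) (Fin n) ℝ}
    (h : PositiveRealLMI A B C P) (hP : P.PosSemidef) (x : EuclideanSpace ℝ (Fin n))
    (u : EuclideanSpace ℝ (Fin m)) :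
    inner ℝ (P.toEuclideanLin x) (A.toEuclideanLin x + B.toEuclideanLin u) ≤
      inner ℝ (C.toEuclideanLin x) u := by
  have h1 := h.dotProduct_mulVec_nonneg (Sum.elim x.ofLp u.ofLp)
  have hPt : Pᵀ = P := by simpa [Matrix.IsHermitian] using hP.1.eq
  simp only [star_trivial, Matrix.neg_mulVec, dotProduct_neg, Matrix.fromBlocks_mulVec,
    Sum.elim_comp_inl, Sum.elim_comp_inr, sumElim_dotProduct_sumElim] at h1
  simp only [EuclideanSpace.inner_eq_star_dotProduct, star_trivial, WithLp.ofLp_add,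
    Matrix.ofLp_toLpLin, Matrix.toLin'_apply]
  generalize x.ofLp = x at *
  generalize u.ofLp = u at *
  have e1 : ∀ {k : ℕ} (D : Matrix (Fin n) (Fin k) ℝ) (a : Fin k → ℝ),
      x ⬝ᵥ P *ᵥ (D *ᵥ a) = (D *ᵥ a) ⬝ᵥ (P *ᵥ x) := by
    intro k D a
    rw [Matrix.dotProduct_mulVec, ← Matrix.mulVec_transpose, hPt, dotProduct_comm]
  have e2 : ∀ {k l : ℕ} (D : Matrix (Fin k) (Fin l) ℝ) (a : Fin l → ℝ) (b : Fin k → ℝ),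
      a ⬝ᵥ Dᵀ *ᵥ b = (D *ᵥ a) ⬝ᵥ b := by
    intro k l D a b
    rw [Matrix.dotProduct_mulVec, Matrix.vecMul_transpose]
  simp only [Matrix.add_mulVec, Matrix.sub_mulVec, ← Matrix.mulVec_mulVec, dotProduct_add,
    dotProduct_sub, e1, e2, Matrix.zero_mulVec, dotProduct_zero] at h1
  rw [add_dotProduct]
  have e3 : u ⬝ᵥ C *ᵥ x = (C *ᵥ x) ⬝ᵥ u := dotProduct_comm _ _
  rw [e3] at h1 ⊢
  linarith

/-- Detectability provides a second storage function, definite and decaying up to the size of input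
and output. -/
theorem IsDetectable.exists_lyapunov {n m : ℕ} {A : Matrix (Fin n) (Fin n) ℝ}
    {C : Matrix (Fin m) (Fin n) ℝ} (h : IsDetectable C A) (B : Matrix (Fin n) (Fin m) ℝ) :
    ∃ (Q : EuclideanSpace ℝ (Fin n) →L[ℝ] EuclideanSpace ℝ (Fin n)) (a b : ℝ), 0 < a ∧ 0 < b ∧
      (∀ x y, inner ℝ (Q x) y = inner ℝ x (Q y)) ∧ (∀ x, ‖x‖ ^ 2 ≤ inner ℝ (Q x) x) ∧
      ∀ x u, inner ℝ (Q x) (A.toEuclideanLin x + B.toEuclideanLin u) ≤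
        -a * inner ℝ (Q x) x + b * √(inner ℝ (Q x) x) * (‖C.toEuclideanLin x‖ + ‖u‖) := by
  obtain ⟨H, hH⟩ := h
  obtain ⟨Q, δ, hδ, hsymm, hlow, hdec⟩ := hH.exists_lyapunov
  set L := fun D : Matrix (Fin n) (Fin m) ℝ => (D.toEuclideanLin).toContinuousLinearMap with hL
  have hLa : ∀ D u, D.toEuclideanLin u = L D u := fun _ _ => rfl
  refine ⟨Q, δ / (‖Q‖ + 1), ‖Q‖ * (‖L H‖ + ‖L B‖) + 1, by positivity, by positivity,
    hsymm, hlow, fun x u => ?_⟩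
  have hsplit : A.toEuclideanLin x + B.toEuclideanLin u =
      (A + H * C).toEuclideanLin x - L H (C.toEuclideanLin x) + L B u := by
    have : (H * C).toEuclideanLin x = H.toEuclideanLin (C.toEuclideanLin x) := by
      ext i
      simp [Matrix.toLpLin_apply, Matrix.mulVec_mulVec]
    rw [map_add, LinearMap.add_apply, this]
    simp [hLa]
  set y := C.toEuclideanLin x
  have hQ0 : (0 : ℝ) ≤ inner ℝ (Q x) x := (sq_nonneg _).trans (hlow x)
  have hN : ‖x‖ ≤ √(inner ℝ (Q x) x) := Real.le_sqrt_of_sq_le (hlow x)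
  have hQx : ‖Q x‖ ≤ ‖Q‖ * ‖x‖ := Q.le_opNorm x
  have hup : inner ℝ (Q x) x ≤ (‖Q‖ + 1) * ‖x‖ ^ 2 := by
    calc inner ℝ (Q x) x ≤ ‖Q x‖ * ‖x‖ := real_inner_le_norm _ _
      _ ≤ (‖Q‖ * ‖x‖) * ‖x‖ := by gcongr
      _ ≤ _ := by nlinarith [sq_nonneg ‖x‖]
  have h1 : δ / (‖Q‖ + 1) * inner ℝ (Q x) x ≤ δ * ‖x‖ ^ 2 := by
    rw [div_mul_eq_mul_div, div_le_iff₀ (by positivity)]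
    calc δ * inner ℝ (Q x) x ≤ δ * ((‖Q‖ + 1) * ‖x‖ ^ 2) := by gcongr
      _ = _ := by ring
  have h2 : -inner ℝ (Q x) (L H y) ≤ ‖Q‖ * ‖x‖ * (‖L H‖ * ‖y‖) := by
    rw [← inner_neg_right]
    refine (real_inner_le_norm _ _).trans ?_
    rw [norm_neg]
    gcongr
    exact (L H).le_opNorm y
  have h3 : inner ℝ (Q x) (L B u) ≤ ‖Q‖ * ‖x‖ * (‖L B‖ * ‖u‖) := by
    refine (real_inner_le_norm _ _).trans ?_
    gcongr
    exact (L B).le_opNorm u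
  have h4 : ‖Q‖ * ‖x‖ * (‖L H‖ * ‖y‖) + ‖Q‖ * ‖x‖ * (‖L B‖ * ‖u‖) ≤
      (‖Q‖ * (‖L H‖ + ‖L B‖) + 1) * √(inner ℝ (Q x) x) * (‖y‖ + ‖u‖) := by
    calc _ = ‖x‖ * (‖Q‖ * ‖L H‖ * ‖y‖ + ‖Q‖ * ‖L B‖ * ‖u‖) := by ring
      _ ≤ ‖x‖ * ((‖Q‖ * (‖L H‖ + ‖L B‖) + 1) * (‖y‖ + ‖u‖)) := by
        gcongr
        have : 0 ≤ ‖Q‖ * ‖L B‖ * ‖y‖ + ‖Q‖ * ‖L H‖ * ‖u‖ + ‖y‖ + ‖u‖ := by positivity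
        linarith
      _ ≤ √(inner ℝ (Q x) x) * ((‖Q‖ * (‖L H‖ + ‖L B‖) + 1) * (‖y‖ + ‖u‖)) := by gcongr
      _ = _ := by ring
  rw [hsplit, inner_add_right, inner_sub_right]
  have h5 := hdec x
  linarith

/-! ### Comparison functions as order automorphisms of the line -/

theorem OrderIso.pos_of_map_zero {e : ℝ ≃o ℝ} (h0 : e 0 = 0) {s : ℝ} (hs : 0 < s) : 0 < e s :=
  h0 ▸ e.strictMono hs

theorem OrderIso.nonneg_of_map_zero {e : ℝ ≃o ℝ} (h0 : e 0 = 0) {s : ℝ} (hs : 0 ≤ s) : 0 ≤ e s :=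
  h0 ▸ e.monotone hs

theorem OrderIso.symm_map_zero {e : ℝ ≃o ℝ} (h0 : e 0 = 0) : e.symm 0 = 0 := by
  rw [e.symm_apply_eq, h0]

theorem OrderIso.isClassK {e : ℝ ≃o ℝ} (h0 : e 0 = 0) : IsClassK e :=
  ⟨e.continuous.continuousOn, h0, e.strictMono.strictMonoOn _⟩

theorem IsClassK.nonneg {f : ℝ → ℝ} (hf : IsClassK f) {s : ℝ} (hs : 0 ≤ s) : 0 ≤ f s := by
  rw [← hf.map_zero]
  exact hf.strictMonoOn.monotoneOn self_mem_Ici hs hs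

theorem isClassKInf_of_linear_le {f : ℝ → ℝ} (hf : ContinuousOn f (Ici 0)) (h0 : f 0 = 0)
    (hmono : StrictMonoOn f (Ici 0)) {c b : ℝ} (hc : 0 < c) (hle : ∀ s, 1 ≤ s → c * s - b ≤ f s) :
    IsClassKInf f := by
  refine ⟨⟨hf, h0, hmono⟩, fun ⟨y, hy⟩ => ?_⟩
  set s := max 1 ((y + b + 1) / c)
  have hs1 : 1 ≤ s := le_max_left _ _
  have hs2 : (y + b + 1) / c ≤ s := le_max_right _ _
  have h1 := hy ⟨s, zero_le_one.trans hs1, rfl⟩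
  have h2 := hle s hs1
  rw [div_le_iff₀ hc] at hs2
  linarith

/-- Class `𝒦_∞` functions are the restrictions to `[0, ∞)` of the order automorphisms of `ℝ` that
fix zero; inverses, composites and their continuity then come for free. -/
theorem IsClassKInf.exists_orderIso {f : ℝ → ℝ} (hf : IsClassKInf f) :
    ∃ e : ℝ ≃o ℝ, e 0 = 0 ∧ ∀ s, 0 ≤ s → e s = f s := by
  set g : ℝ → ℝ := fun s => if 0 ≤ s then f s else s with hg
  have hgpos : ∀ s, 0 ≤ s → g s = f s := fun s hs => if_pos hs
  have hgneg : ∀ s, s < 0 → g s = s := fun s hs => if_neg hs.not_ge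
  have hmono : StrictMono g := by
    intro s t hst
    rcases le_or_gt 0 s with hs | hs
    · rw [hgpos s hs, hgpos t (hs.trans hst.le)]
      exact hf.strictMonoOn hs (hs.trans hst.le) hst
    · rcases le_or_gt 0 t with ht | ht
      · rw [hgneg s hs, hgpos t ht]
        exact hs.trans_le (hf.toIsClassK.nonneg ht)
      · rwa [hgneg s hs, hgneg t ht]
  have hsurj : Function.Surjective g := by
    intro y
    rcases le_or_gt 0 y with hy | hy
    · obtain ⟨-, ⟨s, hs, rfl⟩, hys⟩ := not_bddAbove_iff.mp hf.unbounded y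
      have hs0 : (0 : ℝ) ≤ s := hs
      obtain ⟨u, hu, hfu⟩ := intermediate_value_Icc hs0 (hf.continuousOn.mono Icc_subset_Ici_self)
        (show y ∈ Icc (f 0) (f s) from ⟨by rwa [hf.map_zero], hys.le⟩)
      exact ⟨u, by rw [hgpos u hu.1, hfu]⟩
    · exact ⟨y, hgneg y hy⟩
  exact ⟨hmono.orderIsoOfSurjective g hsurj, (hgpos 0 le_rfl).trans hf.map_zero, hgpos⟩

/-- A class `𝒦ℒ` function built without solving a differential equation: the bound
`u + t a(u) ≤ r(s)` forces `u` to zero as `t → ∞`. -/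
theorem exists_isClassKL_of_add_mul_le {a p r : ℝ ≃o ℝ} (ha : a 0 = 0) (hp : p 0 = 0)
    (hr : r 0 = 0) : ∃ ψ : ℝ → ℝ → ℝ, IsClassKL ψ ∧
      ∀ s t u, 0 ≤ s → 0 ≤ t → 0 ≤ u → u + t * a u ≤ r s → p u ≤ ψ s t := by
  have hG : ∀ t : ℝ, ∃ e : ℝ ≃o ℝ, e 0 = 0 ∧ ∀ u, 0 ≤ t → 0 ≤ u → e u = u + t * a u := by
    intro t
    rcases le_or_gt 0 t with ht | ht
    · have hK : IsClassKInf fun u => u + t * a u := by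
        refine isClassKInf_of_linear_le (c := 1) (b := 0)
          (by have := a.continuous; fun_prop) (by simp [ha]) ?_ one_pos ?_
        · intro u _ w _ huw
          have := mul_le_mul_of_nonneg_left (a.monotone huw.le) ht
          change u + t * a u < w + t * a w
          linarith
        · intro u hu
          have := mul_nonneg ht (OrderIso.nonneg_of_map_zero ha (zero_le_one.trans hu))
          linarith
      obtain ⟨e, he0, he⟩ := hK.exists_orderIso
      exact ⟨e, he0, fun u _ hu => he u hu⟩
    · exact ⟨OrderIso.refl ℝ, rfl, fun u h => absurd h ht.not_ge⟩
  choose G hG0 hG using hG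
  have hGs : ∀ t, (G t).symm 0 = 0 := fun t => OrderIso.symm_map_zero (hG0 t)
  have hrs : ∀ s, 0 ≤ s → 0 ≤ r s := fun s => OrderIso.nonneg_of_map_zero hr
  have hGn : ∀ t s, 0 ≤ s → 0 ≤ (G t).symm (r s) := fun t s hs =>
    OrderIso.nonneg_of_map_zero (hGs t) (hrs s hs)
  refine ⟨fun s t => p ((G t).symm (r s)), ⟨fun t _ => ?_, fun s hs t ht t' ht' htt' => ?_,
    fun s hs => ?_⟩, fun s t u hs ht hu hle => ?_⟩
  · exact OrderIso.isClassK (e := (r.trans (G t).symm).trans p) (by simp [hr, hGs, hp])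
  · refine p.monotone ?_
    rw [(G t').symm_apply_le, hG t' _ ht' (hGn t s hs)]
    have h1 := hG t _ ht (hGn t s hs)
    rw [OrderIso.apply_symm_apply] at h1
    have h2 := mul_le_mul_of_nonneg_right htt'
      (OrderIso.nonneg_of_map_zero ha (hGn t s hs))
    linarith
  · have h1 : Tendsto (fun t : ℝ => p (a.symm (r s / t))) atTop (𝓝 0) := by
      have h2 : Tendsto (fun t : ℝ => r s / t) atTop (𝓝 0) := tendsto_const_nhds.div_atTop tendsto_id
      have h3 := ((p.continuous.comp a.symm.continuous).tendsto 0).comp h2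
      simpa [Function.comp_def, OrderIso.symm_map_zero ha, hp] using h3
    refine squeeze_zero' ?_ ?_ h1
    · exact Eventually.of_forall fun t => OrderIso.nonneg_of_map_zero hp (hGn t s hs)
    · filter_upwards [eventually_gt_atTop 0] with t ht
      refine p.monotone ?_
      rw [a.le_symm_apply, le_div_iff₀ ht]
      have h4 := hG t _ ht.le (hGn t s hs)
      rw [OrderIso.apply_symm_apply] at h4
      linarith [hGn t s hs]
  · refine p.monotone ?_
    rwa [(G t).le_symm_apply, hG t u ht hu]

/-! ### Differential inequalities for absolutely continuous functions -/

theorem LipschitzOnWith.comp_absolutelyContinuousOnInterval {X Z : Type*} [PseudoMetricSpace X]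
    [PseudoMetricSpace Z] {f : ℝ → X} {g : X → Z} {K : NNReal} {a b : ℝ}
    (hg : LipschitzOnWith K g (f '' uIcc a b)) (hf : AbsolutelyContinuousOnInterval f a b) :
    AbsolutelyContinuousOnInterval (fun t => g (f t)) a b := by
  unfold AbsolutelyContinuousOnInterval at hf ⊢
  refine squeeze_zero' ?_ ?_ (by simpa using hf.const_mul (K : ℝ))
  · exact Eventually.of_forall fun _ => Finset.sum_nonneg fun _ _ => dist_nonneg
  rw [eventually_inf_principal]
  filter_upwards with E hE
  rw [Finset.mul_sum]
  refine Finset.sum_le_sum fun i hi => ?_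
  exact hg.dist_le_mul _ (mem_image_of_mem f (hE.1 i hi).1) _ (mem_image_of_mem f (hE.1 i hi).2)

theorem ContDiff.comp_absolutelyContinuousOnInterval {E : Type*} [NormedAddCommGroup E]
    [NormedSpace ℝ E] [ProperSpace E] {U : E → ℝ} (hU : ContDiff ℝ 1 U) {f : ℝ → E} {a b : ℝ}
    (hf : AbsolutelyContinuousOnInterval f a b) :
    AbsolutelyContinuousOnInterval (fun t => U (f t)) a b := by
  obtain ⟨D, hD⟩ := hf.exists_bound
  obtain ⟨K, hK⟩ := hU.contDiffOn.exists_lipschitzOnWith (by decide)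
    (convex_closedBall (0 : E) D) (isCompact_closedBall (0 : E) D)
  refine (hK.mono ?_).comp_absolutelyContinuousOnInterval hf
  rintro _ ⟨t, ht, rfl⟩
  simpa using hD t ht

namespace AbsolutelyContinuousOnInterval

variable {f : ℝ → ℝ}

theorem le_sub_of_deriv_le {a b K : ℝ} (hab : a ≤ b) (hf : AbsolutelyContinuousOnInterval f a b)
    (hd : ∀ᵐ t, t ∈ Ioo a b → deriv f t ≤ -K) : f b ≤ f a - K * (b - a) := by
  have h1 : ∫ t in a..b, deriv f t ≤ ∫ _ in a..b, -K := by
    refine intervalIntegral.integral_mono_ae_restrict hab hf.intervalIntegrable_deriv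
      intervalIntegrable_const ?_
    rw [← restrict_Ioo_eq_restrict_Icc]
    exact (ae_restrict_iff' measurableSet_Ioo).mpr hd
  rw [hf.integral_deriv_eq_sub, intervalIntegral.integral_const, smul_eq_mul] at h1
  linarith

/-- Gronwall's inequality. -/
theorem le_exp_mul_add_of_deriv_le {T γ κ : ℝ} (hT : 0 ≤ T) (hγ : 0 < γ) (hκ : 0 ≤ κ)
    (hf : AbsolutelyContinuousOnInterval f 0 T)
    (hd : ∀ᵐ t, t ∈ Ioo 0 T → DifferentiableAt ℝ f t ∧ deriv f t ≤ -γ * f t + κ) :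
    f T ≤ Real.exp (-γ * T) * f 0 + κ / γ := by
  have hexp : AbsolutelyContinuousOnInterval (fun t => Real.exp (γ * t)) 0 T :=
    (by fun_prop : ContDiff ℝ 1 fun t => Real.exp (γ * t)).contDiffOn.absolutelyContinuousOnInterval
  have hconst : AbsolutelyContinuousOnInterval (fun _ : ℝ => κ / γ) 0 T :=
    (contDiff_const : ContDiff ℝ 1 fun _ : ℝ => κ / γ).contDiffOn.absolutelyContinuousOnInterval
  have hg := (hexp.mul (hf.sub hconst)).le_sub_of_deriv_le (K := 0) hT ?_
  · simp only [Pi.mul_apply, Pi.sub_apply, mul_zero, Real.exp_zero, one_mul, zero_mul,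
      sub_zero] at hg
    have h1 : Real.exp (-γ * T) * Real.exp (γ * T) = 1 := by
      rw [← Real.exp_add]; simp
    have h2 := mul_le_mul_of_nonneg_left hg (Real.exp_pos (-γ * T)).le
    rw [← mul_assoc, h1, one_mul, mul_sub] at h2
    have h3 : 0 ≤ Real.exp (-γ * T) * (κ / γ) := by positivity
    linarith
  · filter_upwards [hd] with t ht htT
    obtain ⟨hdiff, hle⟩ := ht htT
    have h1 : HasDerivAt (fun t => Real.exp (γ * t)) (Real.exp (γ * t) * γ) t := by
      simpa using ((hasDerivAt_id t).const_mul γ).exp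
    have h2 := h1.mul (hdiff.hasDerivAt.sub (hasDerivAt_const t (κ / γ)))
    rw [h2.deriv]
    have h3 : γ * (κ / γ) = κ := by field_simp
    have h4 : Real.exp (γ * t) * γ * (f t - κ / γ) + Real.exp (γ * t) * (deriv f t - 0)
        = Real.exp (γ * t) * (deriv f t - (-γ * f t + γ * (κ / γ))) := by ring
    simp only [Pi.sub_apply]
    rw [h4, h3, neg_zero]
    exact mul_nonpos_of_nonneg_of_nonpos (Real.exp_pos _).le (by linarith)

/-- Comparison principle for `f' ≤ -a(f) + κ`: either `f` has entered the invariant sublevel set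
`a(f) ≤ 2κ`, or `f` has decreased, at a rate at least half the final value of `a(f)`, all the
time. -/
theorem le_or_add_mul_le_of_deriv_le {a : ℝ ≃o ℝ} {T κ : ℝ} (hT : 0 ≤ T)
    (hκ : 0 ≤ κ) (hf : AbsolutelyContinuousOnInterval f 0 T)
    (hd : ∀ᵐ t, t ∈ Ioo 0 T → deriv f t ≤ -a (f t) + κ) :
    a (f T) ≤ 2 * κ ∨ f T + T * (a (f T) / 2) ≤ f 0 := by
  by_contra! hcon
  obtain ⟨hT1, hT2⟩ := hcon
  have hsub : ∀ {s}, s ∈ Icc 0 T → AbsolutelyContinuousOnInterval f s T := fun {s} hs =>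
    hf.mono (by rw [uIcc_of_le hs.2, uIcc_of_le hT]; exact Icc_subset_Icc_left hs.1)
  have hcont : ContinuousOn f (Icc 0 T) := by
    have := hf.continuousOn
    rwa [uIcc_of_le hT] at this
  -- the sublevel set is never visited, since it could not be left again
  have habove : ∀ s ∈ Icc 0 T, 2 * κ < a (f s) := by
    by_contra! hex
    obtain ⟨s₀, hs₀, hle₀⟩ := hex
    set Z := Icc 0 T ∩ (fun s => a (f s)) ⁻¹' Iic (2 * κ)
    have hZ : IsCompact Z := isCompact_Icc.of_isClosed_subset
      ((a.continuous.comp_continuousOn hcont).preimage_isClosed_of_isClosed isClosed_Icc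
        isClosed_Iic) inter_subset_left
    obtain ⟨s, hs, hmax⟩ := hZ.exists_isGreatest ⟨s₀, hs₀, hle₀⟩
    have hdec := (hsub hs.1).le_sub_of_deriv_le (K := 0) hs.1.2 (by
      filter_upwards [hd] with t ht hst
      have htT : t ∈ Ioo 0 T := ⟨hs.1.1.trans_lt hst.1, hst.2⟩
      have h1 : 2 * κ < a (f t) := by
        by_contra! h
        exact absurd (hmax ⟨Ioo_subset_Icc_self htT, h⟩) (not_le.mpr hst.1)
      linarith [ht htT])
    have h2 : a (f T) ≤ a (f s) := a.monotone (by linarith)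
    have h3 : a (f s) ≤ 2 * κ := hs.2
    linarith
  have hanti : ∀ s ∈ Icc 0 T, f T ≤ f s := by
    intro s hs
    have := (hsub hs).le_sub_of_deriv_le (K := 0) hs.2 (by
      filter_upwards [hd] with t ht hst
      have htT : t ∈ Ioo 0 T := ⟨hs.1.trans_lt hst.1, hst.2⟩
      linarith [ht htT, habove t (Ioo_subset_Icc_self htT)])
    linarith
  have hfin := hf.le_sub_of_deriv_le (K := a (f T) / 2) hT (by
    filter_upwards [hd] with t ht htT
    have h1 := a.monotone (hanti t (Ioo_subset_Icc_self htT))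
    linarith [ht htT, habove t (Ioo_subset_Icc_self htT)])
  linarith

end AbsolutelyContinuousOnInterval

/-! ### Lyapunov functions along trajectories -/

theorem ContinuousLinearMap.contDiff_inner_self {E : Type*} [NormedAddCommGroup E]
    [InnerProductSpace ℝ E] (Q : E →L[ℝ] E) : ContDiff ℝ 1 fun x => (inner ℝ (Q x) x : ℝ) :=
  Q.contDiff.inner ℝ contDiff_id

theorem ContinuousLinearMap.fderiv_inner_self {E : Type*} [NormedAddCommGroup E]
    [InnerProductSpace ℝ E] {Q : E →L[ℝ] E} (hQ : ∀ x y, inner ℝ (Q x) y = inner ℝ x (Q y))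
    (x h : E) : fderiv ℝ (fun x => (inner ℝ (Q x) x : ℝ)) x h = 2 * inner ℝ (Q x) h := by
  rw [fderiv_inner_apply ℝ Q.differentiableAt differentiableAt_fun_id]
  simp only [ContinuousLinearMap.fderiv, fderiv_fun_id, ContinuousLinearMap.id_apply]
  rw [hQ h x, real_inner_comm (Q x) h]
  ring

/-- The matrix inequality makes the quadratic form of `P` a storage function. -/
theorem PositiveRealLMI.exists_storage {n m : ℕ} {A : Matrix (Fin n) (Fin n) ℝ}
    {B : Matrix (Fin n) (Fin m) ℝ} {C : Matrix (Fin m) (Fin n) ℝ} {P : Matrix (Fin n) (Fin n) ℝ}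
    (h : PositiveRealLMI A B C P) (hP : P.PosSemidef) :
    ∃ P : EuclideanSpace ℝ (Fin n) →L[ℝ] EuclideanSpace ℝ (Fin n),
      (∀ x y, inner ℝ (P x) y = inner ℝ x (P y)) ∧ (∀ x, (0 : ℝ) ≤ inner ℝ (P x) x) ∧
      ∀ x u, inner ℝ (P x) (A.toEuclideanLin x + B.toEuclideanLin u) ≤
        inner ℝ (C.toEuclideanLin x) u := by
  have hpos := Matrix.isPositive_toEuclideanLin_iff.mpr hP
  exact ⟨P.toEuclideanLin.toContinuousLinearMap, fun x y => hpos.1 x y,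
    fun x => hpos.2 x, fun x u => h.inner_le hP x u⟩

theorem supNormUpTo_nonneg {m : ℕ} (v : ℝ → EuclideanSpace ℝ (Fin m)) (t : ℝ) :
    0 ≤ supNormUpTo v t :=
  ENNReal.toReal_nonneg

theorem ae_norm_le_supNormUpTo {m : ℕ} {v : ℝ → EuclideanSpace ℝ (Fin m)} {T : ℝ}
    (hv : MemLp v ⊤ (volume.restrict (Icc 0 T))) :
    ∀ᵐ t, t ∈ Ioo 0 T → ‖v t‖ ≤ supNormUpTo v T := by
  have hv' : MemLp v ⊤ (volume.restrict (Ioo 0 T)) :=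
    hv.mono_measure (Measure.restrict_mono Ioo_subset_Icc_self le_rfl)
  refine (ae_restrict_iff' measurableSet_Ioo).mp ?_
  filter_upwards [ae_le_eLpNormEssSup (f := v) (μ := volume.restrict (Ioo 0 T))] with t ht
  rw [← eLpNorm_exponent_top] at ht
  have := ENNReal.toReal_mono hv'.2.ne ht
  simpa [supNormUpTo] using this

theorem supNormUpTo_le_supNormHalfLine {m : ℕ} {v : ℝ → EuclideanSpace ℝ (Fin m)}
    (hv : MemLp v ⊤ (volume.restrict (Ici (0 : ℝ)))) (T : ℝ) :
    supNormUpTo v T ≤ supNormHalfLine v :=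
  ENNReal.toReal_mono hv.2.ne (eLpNorm_mono_measure _
    (Measure.restrict_mono (fun _ ht => le_of_lt (mem_Ioo.mp ht).1) le_rfl))

/-- Only the values of the nonlinearity along the output matter for a trajectory. -/
theorem lureBehaviourInf_of_subset_along {n m : ℕ} {A : Matrix (Fin n) (Fin n) ℝ}
    {B : Matrix (Fin n) (Fin m) ℝ} {C : Matrix (Fin m) (Fin n) ℝ}
    {F F' : EuclideanSpace ℝ (Fin m) → Set (EuclideanSpace ℝ (Fin m))}
    {v : ℝ → EuclideanSpace ℝ (Fin m)} {x : ℝ → EuclideanSpace ℝ (Fin n)}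
    (hvx : (v, x) ∈ lureBehaviourInf A B C F)
    (hF : ∀ t, 0 ≤ t → F (C.toEuclideanLin (x t)) ⊆ F' (C.toEuclideanLin (x t))) :
    (v, x) ∈ lureBehaviourInf A B C F' := by
  obtain ⟨⟨hv, hx, hode⟩, hinf⟩ := hvx
  refine ⟨⟨hv, hx, ?_⟩, hinf⟩
  filter_upwards [hode, ae_restrict_mem measurableSet_Ici] with t ⟨x', hx', hmem⟩ ht
  exact ⟨x', hx', image_mono (hF t ht) hmem⟩

/-- An infinitesimal bound on a continuously differentiable function `U` of the state gives a
differential inequality along trajectories. -/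
theorem lureBehaviourInf.comp_lyapunov {n m : ℕ} {A : Matrix (Fin n) (Fin n) ℝ}
    {B : Matrix (Fin n) (Fin m) ℝ} {C : Matrix (Fin m) (Fin n) ℝ}
    {F : EuclideanSpace ℝ (Fin m) → Set (EuclideanSpace ℝ (Fin m))}
    {v : ℝ → EuclideanSpace ℝ (Fin m)} {x : ℝ → EuclideanSpace ℝ (Fin n)}
    (hvx : (v, x) ∈ lureBehaviourInf A B C F) {T : ℝ} (hT : 0 ≤ T)
    {U : EuclideanSpace ℝ (Fin n) → ℝ} (hU : ContDiff ℝ 1 U) {Φ : ℝ → ℝ}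
    (hΦ : ∀ ξ u w, ‖u‖ ≤ supNormUpTo v T → w ∈ F (C.toEuclideanLin ξ) →
      fderiv ℝ U ξ (A.toEuclideanLin ξ + B.toEuclideanLin (u - w)) ≤ Φ (U ξ)) :
    AbsolutelyContinuousOnInterval (fun t => U (x t)) 0 T ∧
      ∀ᵐ t, t ∈ Ioo 0 T → DifferentiableAt ℝ (fun t => U (x t)) t ∧
        deriv (fun t => U (x t)) t ≤ Φ (U (x t)) := by
  obtain ⟨⟨-, hx, hode⟩, hinf⟩ := hvx
  refine ⟨hU.comp_absolutelyContinuousOnInterval (hx T hT), ?_⟩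
  filter_upwards [(ae_restrict_iff' measurableSet_Ici).mp hode,
    ae_norm_le_supNormUpTo (hinf T hT)] with t hxt hvt ht
  obtain ⟨x', hx', w, hw, hw'⟩ := hxt ht.1.le
  have hchain : HasDerivAt (fun t => U (x t)) (fderiv ℝ U (x t) x') t :=
    ((hU.differentiable (by simp)).differentiableAt.hasFDerivAt).comp_hasDerivAt t hx'
  refine ⟨hchain.differentiableAt, ?_⟩
  rw [hchain.deriv]
  have heq : x' = A.toEuclideanLin (x t) + B.toEuclideanLin (v t - w) := by
    rw [map_sub]
    have h1 : -(B.toEuclideanLin w) =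
        x' - A.toEuclideanLin (x t) - B.toEuclideanLin (v t) := hw'
    rw [sub_eq_add_neg (B.toEuclideanLin (v t)), h1]
    abel
  rw [heq]
  exact hΦ _ _ _ (hvt ht) hw

/-! ### Exponential stability under linear sector bounds -/

/-- The set-valued sector nonlinearity `‖w‖ ≤ a ‖y‖`, `⟨w, y⟩ ≥ ε ‖y‖²`. -/
def linearSectorMap {m : ℕ} (a ε : ℝ) (y : EuclideanSpace ℝ (Fin m)) :
    Set (EuclideanSpace ℝ (Fin m)) :=
  {w | ‖w‖ ≤ a * ‖y‖ ∧ ε * ‖y‖ ^ 2 ≤ inner ℝ w y}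

/-- Under linear sector bounds a sum of multiples of the two quadratic storage functions is a
quadratic ISS Lyapunov function. -/
theorem isExpISS_linearSectorMap {n m : ℕ} {A : Matrix (Fin n) (Fin n) ℝ}
    {B : Matrix (Fin n) (Fin m) ℝ} {C : Matrix (Fin m) (Fin n) ℝ} (hdet : IsDetectable C A)
    (hP : ∃ P : Matrix (Fin n) (Fin n) ℝ, P.PosSemidef ∧ PositiveRealLMI A B C P)
    {a₀ ε : ℝ} (ha₀ : 0 ≤ a₀) (hε : 0 < ε) : IsExpISS A B C (linearSectorMap a₀ ε) := by
  obtain ⟨P₀, hP₀, hLMI⟩ := hP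
  obtain ⟨P, hPs, hPn, hPd⟩ := hLMI.exists_storage hP₀
  obtain ⟨Q, a, b, ha, hb, hQs, hQl, hQd⟩ := hdet.exists_lyapunov B
  set c₁ := 1 + a₀
  set K := 2 * b ^ 2 / a * c₁ ^ 2 / ε with hK
  have hK0 : 0 ≤ K := by positivity
  set S : EuclideanSpace ℝ (Fin n) →L[ℝ] EuclideanSpace ℝ (Fin n) := Q + K • P with hS
  have hSi : ∀ x y, inner ℝ (S x) y = inner ℝ (Q x) y + K * inner ℝ (P x) y := by
    intro x y
    simp [hS, inner_add_left, real_inner_smul_left]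
  have hSs : ∀ x y, inner ℝ (S x) y = inner ℝ x (S y) := by
    intro x y
    rw [hSi, hQs, hPs, hS]
    simp [inner_add_right, real_inner_smul_right]
  set c₃ := ‖S‖ + 1
  have hc₃ : 0 < c₃ := by positivity
  have hSu : ∀ x, inner ℝ (S x) x ≤ c₃ * ‖x‖ ^ 2 := by
    intro x
    calc inner ℝ (S x) x ≤ ‖S x‖ * ‖x‖ := real_inner_le_norm _ _
      _ ≤ (‖S‖ * ‖x‖) * ‖x‖ := by gcongr; exact S.le_opNorm x
      _ ≤ _ := by nlinarith [sq_nonneg ‖x‖]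
  have hSl : ∀ x, ‖x‖ ^ 2 ≤ inner ℝ (S x) x := by
    intro x
    rw [hSi]
    have := mul_nonneg hK0 (hPn x)
    linarith [hQl x]
  set γ := a / c₃ with hγ
  have hγ0 : 0 < γ := by positivity
  set C₀ := 2 * b ^ 2 / a + K / ε with hC₀
  have hC₀0 : 0 < C₀ := by positivity
  -- the dissipation inequality
  have hdiss : ∀ ξ u w, w ∈ linearSectorMap a₀ ε (C.toEuclideanLin ξ) →
      2 * inner ℝ (S ξ) (A.toEuclideanLin ξ + B.toEuclideanLin (u - w)) ≤
        -γ * inner ℝ (S ξ) ξ + C₀ * ‖u‖ ^ 2 := by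
    rintro ξ u w ⟨hw1, hw2⟩
    have hQ1 := hQd ξ (u - w)
    have hP1 := hPd ξ (u - w)
    rw [inner_sub_right, real_inner_comm w] at hP1
    have huw := norm_sub_le u w
    have hyu := real_inner_le_norm (C.toEuclideanLin ξ) u
    set y := C.toEuclideanLin ξ
    rw [hSi]
    have hW : 0 ≤ inner ℝ (Q ξ) ξ := (sq_nonneg ‖ξ‖).trans (hQl ξ)
    set N := √(inner ℝ (Q ξ) ξ) with hN
    have hNsq : inner ℝ (Q ξ) ξ = N ^ 2 := (Real.sq_sqrt hW).symm
    have hN0 : 0 ≤ N := Real.sqrt_nonneg _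
    have hxN : ‖ξ‖ ^ 2 ≤ N ^ 2 := hNsq ▸ hQl ξ
    have hγN : γ * inner ℝ (S ξ) ξ ≤ a * N ^ 2 := by
      calc γ * inner ℝ (S ξ) ξ ≤ γ * (c₃ * N ^ 2) := by
            gcongr
            exact (hSu ξ).trans (by gcongr)
        _ = a * N ^ 2 := by rw [hγ]; field_simp
    set e := c₁ * ‖y‖ + ‖u‖ with he
    have h1 : ‖y‖ + ‖u - w‖ ≤ e := by
      have : c₁ * ‖y‖ = ‖y‖ + a₀ * ‖y‖ := by ring
      linarith
    have h2 : b * N * (‖y‖ + ‖u - w‖) ≤ b * N * e := by gcongr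
    -- Young's inequality
    have h3 : 2 * (b * N * e) ≤ a * N ^ 2 + b ^ 2 / a * e ^ 2 := by
      have := mul_nonneg (inv_nonneg.mpr ha.le) (sq_nonneg (a * N - b * e))
      have h : a⁻¹ * (a * N - b * e) ^ 2 = a * N ^ 2 + b ^ 2 / a * e ^ 2 - 2 * (b * N * e) := by
        field_simp; ring
      linarith
    have h4 : b ^ 2 / a * e ^ 2 ≤ 2 * b ^ 2 / a * (c₁ ^ 2 * ‖y‖ ^ 2 + ‖u‖ ^ 2) := by
      have h : e ^ 2 ≤ 2 * (c₁ ^ 2 * ‖y‖ ^ 2 + ‖u‖ ^ 2) := by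
        nlinarith [sq_nonneg (c₁ * ‖y‖ - ‖u‖)]
      calc b ^ 2 / a * e ^ 2 ≤ b ^ 2 / a * (2 * (c₁ ^ 2 * ‖y‖ ^ 2 + ‖u‖ ^ 2)) := by gcongr
        _ = _ := by ring
    have h5 : 2 * (‖y‖ * ‖u‖) ≤ ε * ‖y‖ ^ 2 + ‖u‖ ^ 2 / ε := by
      have := mul_nonneg (inv_nonneg.mpr hε.le) (sq_nonneg (ε * ‖y‖ - ‖u‖))
      have h : ε⁻¹ * (ε * ‖y‖ - ‖u‖) ^ 2 = ε * ‖y‖ ^ 2 + ‖u‖ ^ 2 / ε - 2 * (‖y‖ * ‖u‖) := by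
        field_simp; ring
      linarith
    have h6 : 2 * inner ℝ (P ξ) (A.toEuclideanLin ξ + B.toEuclideanLin (u - w)) ≤
        -(ε * ‖y‖ ^ 2) + ‖u‖ ^ 2 / ε := by linarith
    have h7 := mul_le_mul_of_nonneg_left h6 hK0
    have h8 : K * (-(ε * ‖y‖ ^ 2) + ‖u‖ ^ 2 / ε) =
        -(2 * b ^ 2 / a * (c₁ ^ 2 * ‖y‖ ^ 2)) + K / ε * ‖u‖ ^ 2 := by
      rw [hK]; field_simp
    rw [h8] at h7
    rw [hNsq] at hQ1
    have h9 : C₀ * ‖u‖ ^ 2 = 2 * b ^ 2 / a * ‖u‖ ^ 2 + K / ε * ‖u‖ ^ 2 := by rw [hC₀]; ring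
    rw [h9]
    linarith
  refine ⟨√c₃ + √(C₀ / γ), γ / 2, by positivity, by positivity, fun v x hvx t ht => ?_⟩
  set d := supNormUpTo v t
  have hd0 : 0 ≤ d := supNormUpTo_nonneg v t
  obtain ⟨hac, hder⟩ := lureBehaviourInf.comp_lyapunov hvx ht S.contDiff_inner_self
    (Φ := fun r => -γ * r + C₀ * d ^ 2) (by
      intro ξ u w hu hw
      rw [ContinuousLinearMap.fderiv_inner_self hSs]
      refine (hdiss ξ u w hw).trans ?_
      gcongr)
  have hgr := hac.le_exp_mul_add_of_deriv_le ht hγ0 (by positivity) hder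
  have hsq : ‖x t‖ ^ 2 ≤ (√c₃ * Real.exp (-(γ / 2) * t) * ‖x 0‖ + √(C₀ / γ) * d) ^ 2 := by
    have h1 : Real.exp (-γ * t) = Real.exp (-(γ / 2) * t) ^ 2 := by
      rw [← Real.exp_nat_mul]; congr 1; push_cast; ring
    calc ‖x t‖ ^ 2 ≤ Real.exp (-γ * t) * inner ℝ (S (x 0)) (x 0) + C₀ * d ^ 2 / γ :=
          (hSl _).trans hgr
      _ ≤ Real.exp (-γ * t) * (c₃ * ‖x 0‖ ^ 2) + C₀ * d ^ 2 / γ := by gcongr; exact hSu _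
      _ = (√c₃ * Real.exp (-(γ / 2) * t) * ‖x 0‖) ^ 2 + (√(C₀ / γ) * d) ^ 2 := by
          rw [mul_pow, mul_pow, mul_pow, Real.sq_sqrt hc₃.le, Real.sq_sqrt (by positivity), h1]
          ring
      _ ≤ _ := by
          have : 0 ≤ (√c₃ * Real.exp (-(γ / 2) * t) * ‖x 0‖) * (√(C₀ / γ) * d) := by positivity
          linarith [add_sq (√c₃ * Real.exp (-(γ / 2) * t) * ‖x 0‖) (√(C₀ / γ) * d)]
  have h2 := abs_le_of_sq_le_sq' hsq (by positivity)
  refine h2.2.trans ?_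
  have h3 : 0 ≤ √(C₀ / γ) * (Real.exp (-(γ / 2) * t) * ‖x 0‖) := by positivity
  have h4 : 0 ≤ √c₃ * d := by positivity
  linarith

/-! ### Nonlinear rescaling of the quadratic storage function -/

/-- The rescaling `ρ` of a quadratic form `N²` with weight `ρ'(N²) = k(N) / (1 + N)`; it is of class
`C¹` up to zero, and of class `𝒦_∞` as a function of `N`. -/
theorem exists_rescaling {k : ℝ → ℝ} (hk : Continuous k)
    (hpos : ∀ r, 0 < r → 0 < k r) (hmono : MonotoneOn k (Ici 0)) :
    ∃ ρ : ℝ → ℝ, ContDiff ℝ 1 ρ ∧ (∀ w, deriv ρ w = k √w / (1 + √w)) ∧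
      IsClassKInf fun r => ρ (r ^ 2) := by
  set q : ℝ → ℝ := fun w => k √w / (1 + √w) with hq
  have hqc : Continuous q :=
    (hk.comp Real.continuous_sqrt).div (continuous_const.add Real.continuous_sqrt)
      fun w => by positivity
  set ρ : ℝ → ℝ := fun w => ∫ s in (0 : ℝ)..w, q s with hρ
  have hder : ∀ w, HasDerivAt ρ (q w) w := fun w =>
    intervalIntegral.integral_hasDerivAt_right (hqc.intervalIntegrable _ _)
      (hqc.stronglyMeasurableAtFilter _ _) hqc.continuousAt
  have hdiff : Differentiable ℝ ρ := fun w => (hder w).differentiableAt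
  have hρc : ContDiff ℝ 1 ρ := by
    rw [contDiff_one_iff_deriv]
    refine ⟨hdiff, ?_⟩
    rwa [funext fun w => (hder w).deriv]
  have hρ0 : ρ 0 = 0 := intervalIntegral.integral_same
  have hρm : StrictMonoOn ρ (Ici 0) := by
    refine strictMonoOn_of_deriv_pos (convex_Ici 0) hdiff.continuous.continuousOn fun w hw => ?_
    rw [interior_Ici] at hw
    rw [(hder w).deriv]
    exact div_pos (hpos _ (Real.sqrt_pos.mpr hw)) (by positivity)
  refine ⟨ρ, hρc, fun w => (hder w).deriv, ?_⟩
  refine isClassKInf_of_linear_le (c := k 1) (b := k 1)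
    (hdiff.continuous.comp (continuous_pow 2)).continuousOn (by simp [hρ0]) ?_ (hpos 1 one_pos) ?_
  · intro r hr s hs hrs
    exact hρm (sq_nonneg r) (sq_nonneg s) (pow_lt_pow_left₀ hrs hr two_ne_zero)
  · intro r hr
    have hr0 : 0 ≤ r := zero_le_one.trans hr
    have hk1 : 0 < k 1 := hpos 1 one_pos
    have h1 := (convex_Icc (1 : ℝ) (r ^ 2)).mul_sub_le_image_sub_of_le_deriv
      hdiff.continuous.continuousOn (hdiff.differentiableOn) (C := k 1 / (1 + r)) (by
        intro w hw
        rw [interior_Icc] at hw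
        rw [(hder w).deriv]
        have hw1 : 1 ≤ √w := Real.one_le_sqrt.mpr hw.1.le
        have hw2 : √w ≤ r := (Real.sqrt_le_left hr0).mpr hw.2.le
        exact div_le_div₀ (hk1.le.trans (hmono (zero_le_one' ℝ) (zero_le_one.trans hw1) hw1))
          (hmono (zero_le_one' ℝ) (zero_le_one.trans hw1) hw1) (by positivity) (by linarith))
      1 (left_mem_Icc.mpr (by nlinarith)) (r ^ 2) (right_mem_Icc.mpr (by nlinarith))
      (by nlinarith)
    have h2 : k 1 / (1 + r) * (r ^ 2 - 1) = k 1 * r - k 1 := by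
      field_simp; ring
    have h3 : 0 ≤ ρ 1 := hρ0 ▸ hρm.monotoneOn self_mem_Ici (zero_le_one' ℝ) zero_le_one
    change k 1 * r - k 1 ≤ ρ (r ^ 2)
    linarith

/-- The weight `k` for which the cross term `N (‖y‖ + ‖w‖)` is dominated by the dissipation `N²` of
the detectability storage function together with the supply `⟨w, y⟩` extracted by the sector.
For `‖y‖ ≤ μ`, either `‖y‖ + ‖w‖` is small relative to `N`, or `‖y‖` is bounded below in terms of
`N`, so that `k(N) ≤ ⟨w, y⟩`; for `‖y‖ > μ` the sector bounds `‖y‖ + ‖w‖` linearly by `⟨w, y⟩`. -/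
theorem exists_weight_sectorMap {m : ℕ} {θ α : ℝ → ℝ} {μ c a b : ℝ} (hθ : IsClassKInf θ)
    (hα : IsClassKInf α) (hμ : 0 < μ) (hc : 0 < c) (ha : 0 < a) (hb : 0 < b) :
    ∃ (k : ℝ → ℝ) (K : ℝ), Continuous k ∧ k 0 = 0 ∧ (∀ r, 0 < r → 0 < k r) ∧
      MonotoneOn k (Ici 0) ∧ (∀ r, k r ≤ 1) ∧ 0 ≤ K ∧
      ∀ (y w : EuclideanSpace ℝ (Fin m)) (N : ℝ), w ∈ sectorMap θ α μ c y → 0 ≤ N →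
        k N / (1 + N) * (2 * b * N * (‖y‖ + ‖w‖)) ≤
          k N / (1 + N) * (a * N ^ 2) + K * inner ℝ w y := by
  have hθ₁ : IsClassKInf fun s => s + θ s := by
    refine isClassKInf_of_linear_le (c := 1) (b := 0) (continuousOn_id.add hθ.continuousOn)
      (by simp [hθ.map_zero]) ?_ one_pos fun s hs => ?_
    · exact (strictMono_id.strictMonoOn _).add hθ.strictMonoOn
    · linarith [hθ.toIsClassK.nonneg (zero_le_one.trans hs)]
  obtain ⟨θ₁, hθ₁0, hθ₁e⟩ := hθ₁.exists_orderIso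
  obtain ⟨α₁, hα₁0, hα₁e⟩ := hα.exists_orderIso
  set z : ℝ → ℝ := fun r => θ₁.symm (a / (2 * b) * r) with hz
  have hz0 : z 0 = 0 := by simp [hz, OrderIso.symm_map_zero hθ₁0]
  have hzm : StrictMono z := fun r s hrs =>
    θ₁.symm.strictMono (mul_lt_mul_of_pos_left hrs (by positivity))
  have hzc : Continuous z := θ₁.symm.continuous.comp (continuous_const.mul continuous_id)
  have hzn : ∀ r, 0 ≤ r → 0 ≤ z r := fun r hr => hz0 ▸ hzm.monotone hr
  set k : ℝ → ℝ := fun r => min 1 (z r * α₁ (z r)) with hk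
  have hkpos : ∀ r, 0 < r → 0 < k r := fun r hr => by
    have h1 : 0 < z r := hz0 ▸ hzm hr
    exact lt_min one_pos (mul_pos h1 (OrderIso.pos_of_map_zero hα₁0 h1))
  have hk0 : k 0 = 0 := by simp [hk, hz0]
  have hαμ : 0 < α μ := hα₁e μ hμ.le ▸ OrderIso.pos_of_map_zero hα₁0 hμ
  have hθμ : 0 ≤ θ μ := hθ.toIsClassK.nonneg hμ.le
  refine ⟨k, 2 * b * ((α μ)⁻¹ + c + (μ + θ μ)), ?_, hk0, hkpos, ?_, fun r => min_le_left _ _,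
    by positivity, ?_⟩
  · exact continuous_const.min (hzc.mul (α₁.continuous.comp hzc))
  · intro r hr s _ hrs
    have h1 := hzm.monotone hrs
    have h2 := hzn r hr
    exact min_le_min le_rfl (mul_le_mul h1 (α₁.monotone h1)
      (OrderIso.nonneg_of_map_zero hα₁0 h2) (h2.trans h1))
  · rintro y w N ⟨hw1, hw2, hw3⟩ hN
    set s : ℝ := inner ℝ w y
    have hY : 0 ≤ ‖y‖ := norm_nonneg y
    have hs : 0 ≤ s := (mul_nonneg hY (hα.toIsClassK.nonneg hY)).trans hw2
    have hkN : 0 ≤ k N := by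
      rcases hN.eq_or_lt with h | h
      · rw [← h, hk0]
      · exact (hkpos N h).le
    have hkN1 : k N ≤ 1 := min_le_left _ _
    have hfrac : N / (1 + N) ≤ 1 := by rw [div_le_one (by positivity)]; linarith
    have hfrac0 : 0 ≤ N / (1 + N) := by positivity
    have hterm : 0 ≤ k N / (1 + N) * (a * N ^ 2) := by positivity
    have hre : k N / (1 + N) * (2 * b * N * (‖y‖ + ‖w‖)) =
        2 * b * (k N * (‖y‖ + ‖w‖)) * (N / (1 + N)) := by ring
    have hle : k N / (1 + N) * (2 * b * N * (‖y‖ + ‖w‖)) ≤ 2 * b * (k N * (‖y‖ + ‖w‖)) := by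
      rw [hre]
      exact mul_le_of_le_one_right (by positivity) hfrac
    rcases lt_or_ge μ ‖y‖ with hyμ | hyμ
    · have h1 : ‖y‖ ≤ (α μ)⁻¹ * s := by
        rw [inv_mul_eq_div, le_div_iff₀ hαμ]
        refine le_trans ?_ hw2
        exact mul_le_mul_of_nonneg_left (hα.strictMonoOn.monotoneOn hμ.le hY hyμ.le) hY
      have h2 : ‖w‖ ≤ c * s := hw3 hyμ
      have h3 : k N * (‖y‖ + ‖w‖) ≤ ((α μ)⁻¹ + c + (μ + θ μ)) * s := by
        calc k N * (‖y‖ + ‖w‖) ≤ 1 * (‖y‖ + ‖w‖) := by gcongr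
          _ ≤ ((α μ)⁻¹ + c) * s := by linarith
          _ ≤ _ := mul_le_mul_of_nonneg_right (by linarith) hs
      have h4 := mul_le_mul_of_nonneg_left h3 (by positivity : 0 ≤ 2 * b)
      linarith
    · rcases le_or_gt (2 * b * (‖y‖ + ‖w‖)) (a * N) with h | h
      · have h1 : 2 * b * N * (‖y‖ + ‖w‖) ≤ a * N ^ 2 := by
          calc 2 * b * N * (‖y‖ + ‖w‖) = N * (2 * b * (‖y‖ + ‖w‖)) := by ring
            _ ≤ N * (a * N) := by gcongr
            _ = _ := by ring
        have h2 : k N / (1 + N) * (2 * b * N * (‖y‖ + ‖w‖)) ≤ k N / (1 + N) * (a * N ^ 2) := by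
          gcongr
        have : 0 ≤ 2 * b * ((α μ)⁻¹ + c + (μ + θ μ)) * s := by positivity
        linarith
      · have h1 : z N ≤ ‖y‖ := by
          rw [hz, θ₁.symm_apply_le, hθ₁e _ hY, div_mul_eq_mul_div, div_le_iff₀ (by positivity)]
          have : 2 * b * (‖y‖ + ‖w‖) ≤ 2 * b * (‖y‖ + θ ‖y‖) := by gcongr
          linarith
        have h2 : k N ≤ s := by
          refine (min_le_right _ _).trans (le_trans ?_ hw2)
          rw [← hα₁e _ hY]
          exact mul_le_mul h1 (α₁.monotone h1)
            (OrderIso.nonneg_of_map_zero hα₁0 (hzn N hN)) hY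
        have h3 : ‖y‖ + ‖w‖ ≤ (α μ)⁻¹ + c + (μ + θ μ) := by
          have := hθ.strictMonoOn.monotoneOn hY hμ.le hyμ
          have : 0 ≤ (α μ)⁻¹ := by positivity
          linarith
        have h4 : k N * (‖y‖ + ‖w‖) ≤ s * ((α μ)⁻¹ + c + (μ + θ μ)) := by gcongr
        have h5 := mul_le_mul_of_nonneg_left h4 (by positivity : 0 ≤ 2 * b)
        linarith

/-! ### Input-to-state stability -/

theorem isClassKInf_dissipation {k : ℝ → ℝ} (hk : Continuous k) (hpos : ∀ r, 0 < r → 0 < k r)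
    (hmono : MonotoneOn k (Ici 0)) {a : ℝ} (ha : 0 < a) :
    IsClassKInf fun N => k N / (1 + N) * (a * N ^ 2) := by
  have hc : ContinuousOn (fun N => k N / (1 + N) * (a * N ^ 2)) (Ici 0) := by
    refine (hk.continuousOn.div (by fun_prop) fun N hN => ?_).mul (by fun_prop)
    have : (0 : ℝ) ≤ N := hN
    positivity
  have h1 := hpos 1 one_pos
  refine isClassKInf_of_linear_le (c := k 1 * a) (b := k 1 * a) hc (by simp) ?_ (by positivity) ?_
  · intro r hr s hs hrs
    have hr0 : (0 : ℝ) ≤ r := hr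
    have hs0 : (0 : ℝ) < s := hr0.trans_lt hrs
    have hks := hpos s hs0
    have h2 : r ^ 2 / (1 + r) < s ^ 2 / (1 + s) := by
      rw [div_lt_div_iff₀ (by positivity) (by positivity)]
      nlinarith [mul_nonneg hr0 hs0.le, mul_pos (sub_pos.mpr hrs) hs0]
    change k r / (1 + r) * (a * r ^ 2) < k s / (1 + s) * (a * s ^ 2)
    calc k r / (1 + r) * (a * r ^ 2) = a * (k r * (r ^ 2 / (1 + r))) := by ring
      _ ≤ a * (k s * (r ^ 2 / (1 + r))) := by gcongr; exact hmono hr hs hrs.le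
      _ < a * (k s * (s ^ 2 / (1 + s))) := by gcongr
      _ = _ := by ring
  · intro s hs
    have hs0 : 0 < s := one_pos.trans_le hs
    have h2 : s - 1 ≤ s ^ 2 / (1 + s) := by
      rw [le_div_iff₀ (by positivity)]; nlinarith
    have h3 : k 1 ≤ k s := hmono (zero_le_one' ℝ) hs0.le hs
    calc k 1 * a * s - k 1 * a = a * (k 1 * (s - 1)) := by ring
      _ ≤ a * (k s * (s ^ 2 / (1 + s))) := by
        have : 0 ≤ s - 1 := by linarith
        have : 0 ≤ k s := (hpos s hs0).le
        gcongr
      _ = _ := by ring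

/-- The function `U = ρ(⟨Q x, x⟩) + K ⟨P x, x⟩` is an ISS Lyapunov function: with
`N² = ⟨Q x, x⟩` and `d` the size of the input, its derivative along trajectories is at most
`-a k(N) N² / (1 + N) + 2 K d α⁻¹(2 d) + 2 b d`, because the supply `⟨w, y⟩` that `ρ(N²)` picks up
is taken back by the passivity of the second summand. -/
theorem isISS_sectorMap {n m : ℕ} {A : Matrix (Fin n) (Fin n) ℝ} {B : Matrix (Fin n) (Fin m) ℝ}
    {C : Matrix (Fin m) (Fin n) ℝ} {θ α : ℝ → ℝ} {μ c : ℝ} (hθ : IsClassKInf θ)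
    (hα : IsClassKInf α) (hμ : 0 < μ) (hc : 0 < c) (hdet : IsDetectable C A)
    (hP : ∃ P : Matrix (Fin n) (Fin n) ℝ, P.PosSemidef ∧ PositiveRealLMI A B C P) :
    IsISS A B C (sectorMap θ α μ c) := by
  obtain ⟨P₀, hP₀, hLMI⟩ := hP
  obtain ⟨P, hPs, hPn, hPd⟩ := hLMI.exists_storage hP₀
  obtain ⟨Q, a, b, ha, hb, hQs, hQl, hQd⟩ := hdet.exists_lyapunov B
  obtain ⟨k, K, hkc, hk0, hkpos, hkm, hk1, hK, hkw⟩ :=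
    exists_weight_sectorMap (m := m) hθ hα hμ hc ha hb
  obtain ⟨ρ, hρc, hρd, hρK⟩ := exists_rescaling hkc hkpos hkm
  obtain ⟨α₁, hα₁0, hα₁e⟩ := hα.exists_orderIso
  have hαs0 : α₁.symm 0 = 0 := OrderIso.symm_map_zero hα₁0
  -- lower bound of the Lyapunov function in terms of `N`
  obtain ⟨lo, hlo0, hlo⟩ := hρK.exists_orderIso
  -- upper bound of the Lyapunov function in terms of `N`
  obtain ⟨up, hup0, hup⟩ : ∃ e : ℝ ≃o ℝ, e 0 = 0 ∧
      ∀ s, 0 ≤ s → e s = ρ (s ^ 2) + (K * ‖P‖ + 1) * s ^ 2 := by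
    refine IsClassKInf.exists_orderIso (isClassKInf_of_linear_le (c := 1) (b := 0) ?_ ?_ ?_
      one_pos ?_)
    · exact hρK.continuousOn.add (by fun_prop)
    · have := hρK.map_zero
      simp only [ne_eq, OfNat.ofNat_ne_zero, not_false_eq_true, zero_pow] at this
      simp [this]
    · intro r hr s hs hrs
      have h1 := hρK.strictMonoOn hr hs hrs
      have h2 : r ^ 2 ≤ s ^ 2 := pow_le_pow_left₀ hr hrs.le 2
      have h3 : (K * ‖P‖ + 1) * r ^ 2 ≤ (K * ‖P‖ + 1) * s ^ 2 := by gcongr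
      exact add_lt_add_of_lt_of_le h1 h3
    · intro s hs
      have h1 := hρK.toIsClassK.nonneg (zero_le_one.trans hs)
      have h2 : 0 ≤ K * ‖P‖ * s ^ 2 := by positivity
      change 1 * s - 0 ≤ ρ (s ^ 2) + (K * ‖P‖ + 1) * s ^ 2
      nlinarith
  obtain ⟨dis, hdis0, hdis⟩ := (isClassKInf_dissipation hkc hkpos hkm ha).exists_orderIso
  obtain ⟨σ, hσ0, hσ⟩ : ∃ e : ℝ ≃o ℝ, e 0 = 0 ∧
      ∀ d, 0 ≤ d → e d = 2 * (K * (2 * d * α₁.symm (2 * d)) + 2 * b * d) := by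
    refine IsClassKInf.exists_orderIso (isClassKInf_of_linear_le (c := 4 * b) (b := 0) ?_ ?_ ?_
      (by positivity) ?_)
    · have := α₁.symm.continuous
      exact Continuous.continuousOn (by fun_prop)
    · simp
    · intro r hr s hs hrs
      have hr0 : (0 : ℝ) ≤ r := hr
      have h1 : α₁.symm (2 * r) ≤ α₁.symm (2 * s) := α₁.symm.monotone (by linarith)
      have h2 : 0 ≤ α₁.symm (2 * r) := OrderIso.nonneg_of_map_zero hαs0 (by linarith)
      have h3 : K * (2 * r * α₁.symm (2 * r)) ≤ K * (2 * s * α₁.symm (2 * s)) := by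
        have := hs.out
        gcongr
      have h4 : 2 * b * r < 2 * b * s := by gcongr
      change 2 * (_ + _) < 2 * (_ + _)
      linarith
    · intro s hs
      have hs0 : 0 ≤ s := zero_le_one.trans hs
      have h2 : 0 ≤ α₁.symm (2 * s) := OrderIso.nonneg_of_map_zero hαs0 (by linarith)
      have h3 : 0 ≤ K * (2 * s * α₁.symm (2 * s)) := by positivity
      linarith
  set rate : ℝ ≃o ℝ := up.symm.trans dis with hrate
  have hrate0 : rate 0 = 0 := by simp [hrate, OrderIso.symm_map_zero hup0, hdis0]
  set c₂ := ‖Q‖ + 1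
  have hc₂ : 0 < c₂ := by positivity
  set ini : ℝ ≃o ℝ := (OrderIso.mulLeft₀ c₂ hc₂).trans up with hini
  have hini_apply : ∀ s, ini s = up (c₂ * s) := fun s => rfl
  set half : ℝ ≃o ℝ := rate.trans (OrderIso.mulLeft₀ (2⁻¹ : ℝ) (by norm_num)) with hhalf
  have hhalf_apply : ∀ s, half s = 2⁻¹ * rate s := fun s => rfl
  obtain ⟨ψ, hψ, hψb⟩ := exists_isClassKL_of_add_mul_le (a := half) (p := lo.symm) (r := ini)
    (by rw [hhalf_apply, hrate0, mul_zero]) (OrderIso.symm_map_zero hlo0)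
    (by rw [hini_apply, mul_zero, hup0])
  set φ : ℝ ≃o ℝ := (σ.trans rate.symm).trans lo.symm with hφ
  have hφ0 : φ 0 = 0 := by
    simp [hφ, hσ0, OrderIso.symm_map_zero hrate0, OrderIso.symm_map_zero hlo0]
  refine ⟨ψ, φ, hψ, OrderIso.isClassK hφ0, fun v x hvx t ht => ?_⟩
  set d := supNormUpTo v t with hd
  have hd0 : 0 ≤ d := supNormUpTo_nonneg v t
  set U : EuclideanSpace ℝ (Fin n) → ℝ := fun ξ => ρ (inner ℝ (Q ξ) ξ) + K * inner ℝ (P ξ) ξ with hU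
  have hUc : ContDiff ℝ 1 U :=
    (hρc.comp Q.contDiff_inner_self).add (contDiff_const.mul P.contDiff_inner_self)
  have hUd : ∀ ξ h, fderiv ℝ U ξ h =
      k √(inner ℝ (Q ξ) ξ) / (1 + √(inner ℝ (Q ξ) ξ)) * (2 * inner ℝ (Q ξ) h) +
        K * (2 * inner ℝ (P ξ) h) := by
    intro ξ h
    have hQf := (Q.contDiff_inner_self.differentiable one_ne_zero ξ).hasFDerivAt
    have hPf := (P.contDiff_inner_self.differentiable one_ne_zero ξ).hasFDerivAt
    have hρf := (hρc.differentiable one_ne_zero (inner ℝ (Q ξ) ξ)).hasDerivAt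
    have h1 := (HasDerivAt.comp_hasFDerivAt (f := fun x => (inner ℝ (Q x) x : ℝ)) ξ hρf hQf).add (hPf.const_mul K)
    have h2 : fderiv ℝ U ξ = _ := h1.fderiv
    rw [h2, add_apply, smul_apply,
      smul_apply, ContinuousLinearMap.fderiv_inner_self hQs,
      ContinuousLinearMap.fderiv_inner_self hPs, hρd]
    rfl
  have hNsq : ∀ ξ, inner ℝ (Q ξ) ξ = √(inner ℝ (Q ξ) ξ) ^ 2 := fun ξ =>
    (Real.sq_sqrt ((sq_nonneg ‖ξ‖).trans (hQl ξ))).symm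
  have hxN : ∀ ξ, ‖ξ‖ ≤ √(inner ℝ (Q ξ) ξ) := fun ξ => Real.le_sqrt_of_sq_le (hQl ξ)
  have hUlo : ∀ ξ, lo √(inner ℝ (Q ξ) ξ) ≤ U ξ := by
    intro ξ
    rw [hlo _ (Real.sqrt_nonneg _), ← hNsq]
    exact le_add_of_nonneg_right (mul_nonneg hK (hPn ξ))
  have hUup : ∀ ξ, U ξ ≤ up √(inner ℝ (Q ξ) ξ) := by
    intro ξ
    rw [hup _ (Real.sqrt_nonneg _), ← hNsq]
    refine add_le_add_right ?_ _
    calc K * inner ℝ (P ξ) ξ ≤ K * (‖P ξ‖ * ‖ξ‖) := by gcongr; exact real_inner_le_norm _ _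
      _ ≤ K * (‖P‖ * ‖ξ‖ * ‖ξ‖) := by gcongr; exact P.le_opNorm ξ
      _ = K * ‖P‖ * ‖ξ‖ ^ 2 := by ring
      _ ≤ K * ‖P‖ * inner ℝ (Q ξ) ξ := by gcongr; exact hQl ξ
      _ ≤ (K * ‖P‖ + 1) * inner ℝ (Q ξ) ξ := by
        gcongr
        · exact (sq_nonneg ‖ξ‖).trans (hQl ξ)
        · linarith
  obtain ⟨hac, hder⟩ := lureBehaviourInf.comp_lyapunov hvx ht hUc
    (Φ := fun r => -rate r + σ d / 2) (by
      intro ξ u w hu hw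
      rw [hUd]
      have hkw' := hkw _ w √(inner ℝ (Q ξ) ξ) hw (Real.sqrt_nonneg _)
      obtain ⟨-, hw2, -⟩ := hw
      have hQ1 := hQd ξ (u - w)
      have hP1 := hPd ξ (u - w)
      rw [inner_sub_right, real_inner_comm w] at hP1
      have huw := norm_sub_le u w
      have hyu := real_inner_le_norm (C.toEuclideanLin ξ) u
      set y := C.toEuclideanLin ξ
      have hY : 0 ≤ ‖y‖ := norm_nonneg y
      have hrateU : rate (U ξ) ≤ dis √(inner ℝ (Q ξ) ξ) :=
        dis.monotone ((up.symm_apply_le).mpr (hUup ξ))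
      rw [hNsq ξ, Real.sqrt_sq (Real.sqrt_nonneg _)] at hQ1
      rw [hdis _ (Real.sqrt_nonneg _)] at hrateU
      set N := √(inner ℝ (Q ξ) ξ) with hN
      have hN0 : 0 ≤ N := Real.sqrt_nonneg _
      have hkN : 0 ≤ k N := by
        rcases hN0.eq_or_lt with h | h
        · rw [← h, hk0]
        · exact (hkpos N h).le
      -- passivity: the forcing is absorbed by the supply unless `α ‖y‖ < 2 d`
      have hyd : 2 * (‖y‖ * d) ≤ inner ℝ w y + 2 * d * α₁.symm (2 * d) := by
        have hαd : 0 ≤ α₁.symm (2 * d) := OrderIso.nonneg_of_map_zero hαs0 (by linarith)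
        have hs : 0 ≤ (inner ℝ w y : ℝ) :=
          (mul_nonneg hY (hα.toIsClassK.nonneg hY)).trans hw2
        rcases le_or_gt ‖y‖ (α₁.symm (2 * d)) with h | h
        · have := mul_le_mul_of_nonneg_right h hd0
          linarith
        · have h1 : 2 * d ≤ α ‖y‖ := by
            rw [← hα₁e _ hY]
            exact (α₁.symm_apply_le.mp h.le)
          have h2 := mul_le_mul_of_nonneg_left h1 hY
          have h3 : 0 ≤ 2 * d * α₁.symm (2 * d) := by positivity
          linarith
      have hyu' : ‖y‖ * ‖u‖ ≤ ‖y‖ * d := by gcongr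
      have hV : 2 * inner ℝ (P ξ) (A.toEuclideanLin ξ + B.toEuclideanLin (u - w)) ≤
          -inner ℝ w y + 2 * d * α₁.symm (2 * d) := by linarith
      have hV' := mul_le_mul_of_nonneg_left hV hK
      have hfrac : N / (1 + N) ≤ 1 := by rw [div_le_one (by positivity)]; linarith
      have hfrac0 : 0 ≤ N / (1 + N) := by positivity
      have hW : 2 * inner ℝ (Q ξ) (A.toEuclideanLin ξ + B.toEuclideanLin (u - w)) ≤
          -2 * (a * N ^ 2) + 2 * b * N * (‖y‖ + ‖w‖) + 2 * b * N * d := by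
        have : b * N * (‖y‖ + ‖u - w‖) ≤ b * N * (‖y‖ + (d + ‖w‖)) := by
          gcongr
          linarith
        linarith
      have hW' := mul_le_mul_of_nonneg_left hW (by positivity : 0 ≤ k N / (1 + N))
      have hWd : k N / (1 + N) * (2 * b * N * d) ≤ 2 * b * d := by
        calc k N / (1 + N) * (2 * b * N * d) = k N * (N / (1 + N)) * (2 * b * d) := by ring
          _ ≤ 1 * 1 * (2 * b * d) := by gcongr; exact hk1 N
          _ = _ := by ring
      have hσd := hσ d hd0
      rw [mul_add, mul_add] at hW'
      linarith)
  have hσd0 : 0 ≤ σ d := OrderIso.nonneg_of_map_zero hσ0 hd0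
  have hψ0 : 0 ≤ ψ ‖x 0‖ t := (hψ.classK t ht).nonneg (norm_nonneg _)
  have hφd : 0 ≤ φ d := OrderIso.nonneg_of_map_zero hφ0 hd0
  have hxt : ‖x t‖ ≤ lo.symm (U (x t)) := (hxN _).trans ((lo.le_symm_apply).mpr (hUlo _))
  rcases hac.le_or_add_mul_le_of_deriv_le ht (by positivity)
    (hder.mono fun s hs h => (hs h).2) with h | h
  · have h1 : U (x t) ≤ rate.symm (σ d) := (rate.le_symm_apply).mpr (by linarith)
    have h2 : lo.symm (U (x t)) ≤ φ d := lo.symm.monotone h1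
    linarith
  · have hUn : 0 ≤ U (x t) :=
      (OrderIso.nonneg_of_map_zero hlo0 (Real.sqrt_nonneg _)).trans (hUlo _)
    have hx0 : √(inner ℝ (Q (x 0)) (x 0)) ≤ c₂ * ‖x 0‖ := by
      refine Real.sqrt_le_iff.mpr ⟨by positivity, ?_⟩
      calc inner ℝ (Q (x 0)) (x 0) ≤ ‖Q (x 0)‖ * ‖x 0‖ := real_inner_le_norm _ _
        _ ≤ ‖Q‖ * ‖x 0‖ * ‖x 0‖ := by gcongr; exact Q.le_opNorm _
        _ = ‖Q‖ * ‖x 0‖ ^ 2 := by ring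
        _ ≤ c₂ ^ 2 * ‖x 0‖ ^ 2 := by
          gcongr
          have := norm_nonneg Q
          change ‖Q‖ ≤ (‖Q‖ + 1) ^ 2
          nlinarith
        _ = _ := by ring
    have h1 := hψb ‖x 0‖ t (U (x t)) (norm_nonneg _) ht hUn (by
      rw [hhalf_apply, hini_apply]
      have h2 : U (x 0) ≤ up (c₂ * ‖x 0‖) := (hUup _).trans (up.monotone hx0)
      linarith)
    linarith

/-! ### Semi-global and global exponential stability -/

/-- Input-to-state stability confines the trajectories with data of size at most `R` to a fixed
ball, so that it suffices to embed the nonlinearity, on bounded sets of outputs, into others whose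
inclusions are exponentially stable. -/
theorem IsISS.isSemiGlobalExpISS {n m : ℕ} {A : Matrix (Fin n) (Fin n) ℝ}
    {B : Matrix (Fin n) (Fin m) ℝ} {C : Matrix (Fin m) (Fin n) ℝ}
    {F : EuclideanSpace ℝ (Fin m) → Set (EuclideanSpace ℝ (Fin m))} (hF : IsISS A B C F)
    (hloc : ∀ r : ℝ, 0 ≤ r → ∃ F' : EuclideanSpace ℝ (Fin m) → Set (EuclideanSpace ℝ (Fin m)),
      IsExpISS A B C F' ∧ ∀ y, ‖y‖ ≤ r → F y ⊆ F' y) : IsSemiGlobalExpISS A B C F := by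
  obtain ⟨ψ, φ, hψ, hφ, hbound⟩ := hF
  intro R hR
  set L := (C.toEuclideanLin).toContinuousLinearMap
  have hψR : 0 ≤ ψ R 0 := (hψ.classK 0 le_rfl).nonneg hR.le
  have hφR : 0 ≤ φ R := hφ.nonneg hR.le
  obtain ⟨F', ⟨M, γ, hM, hγ, hexp⟩, hsub⟩ := hloc (‖L‖ * (ψ R 0 + φ R)) (by positivity)
  refine ⟨M, γ, hM, hγ, fun v x hvx hv hvR => hexp v x ?_⟩
  have hs0 : 0 ≤ supNormHalfLine v := ENNReal.toReal_nonneg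
  have hx0 := norm_nonneg (x 0)
  refine lureBehaviourInf_of_subset_along hvx fun t ht => hsub _ ?_
  have hψ1 : ψ ‖x 0‖ t ≤ ψ R 0 :=
    (hψ.antitoneOn _ hx0 self_mem_Ici ht ht).trans
      ((hψ.classK 0 le_rfl).strictMonoOn.monotoneOn hx0 hR.le (by linarith))
  have hφ1 : φ (supNormUpTo v t) ≤ φ R :=
    hφ.strictMonoOn.monotoneOn (supNormUpTo_nonneg v t) hR.le
      ((supNormUpTo_le_supNormHalfLine hv t).trans (by linarith))
  calc ‖C.toEuclideanLin (x t)‖ ≤ ‖L‖ * ‖x t‖ := L.le_opNorm _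
    _ ≤ ‖L‖ * (ψ R 0 + φ R) := by
      gcongr
      exact (hbound v x hvx t ht).trans (add_le_add hψ1 hφ1)

theorem sectorMap_subset_linearSectorMap {m : ℕ} {θ α : ℝ → ℝ} {μ c a ε : ℝ}
    {y : EuclideanSpace ℝ (Fin m)} (hθ : θ ‖y‖ ≤ a * ‖y‖) (hα : ε * ‖y‖ ≤ α ‖y‖) :
    sectorMap θ α μ c y ⊆ linearSectorMap a ε y := by
  rintro w ⟨hw1, hw2, -⟩
  refine ⟨hw1.trans hθ, le_trans ?_ hw2⟩
  have := mul_le_mul_of_nonneg_left hα (norm_nonneg y)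
  linarith

theorem ContDiffOn.exists_le_mul_of_map_zero {θ : ℝ → ℝ} (hθ : ContDiffOn ℝ 1 θ (Ici 0))
    (h0 : θ 0 = 0) (r : ℝ) : ∃ a : ℝ, 0 ≤ a ∧ ∀ s, 0 ≤ s → s ≤ r → θ s ≤ a * s := by
  obtain ⟨K, hK⟩ := (hθ.mono (Icc_subset_Ici_self : Icc 0 r ⊆ Ici 0)).exists_lipschitzOnWith (by decide)
    (convex_Icc _ _) isCompact_Icc
  refine ⟨K, K.2, fun s hs hsr => ?_⟩
  have h1 := hK.dist_le_mul s ⟨hs, hsr⟩ 0 ⟨le_rfl, hs.trans hsr⟩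
  rw [h0, dist_zero_right, dist_zero_right, Real.norm_eq_abs, Real.norm_of_nonneg hs] at h1
  exact (le_abs_self _).trans h1

theorem mainTheorem1 (n m : ℕ)
    (A : Matrix (Fin n) (Fin n) ℝ) (B : Matrix (Fin n) (Fin m) ℝ) (C : Matrix (Fin m) (Fin n) ℝ)
    (θ α : ℝ → ℝ) (μ c : ℝ)
    (hθ : IsClassKInf θ) (hθ' : ContDiffOn ℝ 1 θ (Set.Ici 0))
    (hα : ∀ s, 0 ≤ s → 0 ≤ α s ∧ α s ≤ θ s)
    (hμ : 0 < μ) (hc : 0 < c) (hcμ : 1 ≤ c * μ)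
    (hdet : IsDetectable C A)
    (hP : ∃ P : Matrix (Fin n) (Fin n) ℝ, P.PosSemidef ∧ PositiveRealLMI A B C P) :
    (IsClassKInf α → IsISS A B C (sectorMap θ α μ c)) ∧
    (IsClassKInf α → (∃ ε₀ : ℝ, 0 < ε₀ ∧ ∀ s, 0 ≤ s → ε₀ * s ≤ α s) →
      IsSemiGlobalExpISS A B C (sectorMap θ α μ c) ∧
      (IsLinearlyBounded θ → IsExpISS A B C (sectorMap θ α μ c))) := by
  refine ⟨fun hαK => isISS_sectorMap hθ hαK hμ hc hdet hP, fun hαK ⟨ε, hε, hαε⟩ => ⟨?_, ?_⟩⟩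
  · refine (isISS_sectorMap hθ hαK hμ hc hdet hP).isSemiGlobalExpISS fun r _ => ?_
    obtain ⟨a, ha, hθa⟩ := hθ'.exists_le_mul_of_map_zero hθ.map_zero r
    exact ⟨linearSectorMap a ε, isExpISS_linearSectorMap hdet hP ha hε, fun y hy =>
      sectorMap_subset_linearSectorMap (hθa _ (norm_nonneg y) hy) (hαε _ (norm_nonneg y))⟩
  · rintro ⟨a, ha, hθa⟩
    obtain ⟨M, γ, hM, hγ, hexp⟩ := isExpISS_linearSectorMap hdet hP ha.le hε
    refine ⟨M, γ, hM, hγ, fun v x hvx => hexp v x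
      (lureBehaviourInf_of_subset_along hvx fun t _ => ?_)⟩
    have h1 := hθa _ (norm_nonneg (C.toEuclideanLin (x t)))
    rw [abs_of_nonneg (norm_nonneg _)] at h1
    exact sectorMap_subset_linearSectorMap ((le_abs_self _).trans h1) (hαε _ (norm_nonneg _))
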